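/- Consider the quantum mechanics of one complex bosonic variable $\phi$ and two fermionic variables $\psi_1,\psi_2$: the Hilbert space is $L^2(\mathbb{C})\otimes\mathcal F$, where $\mathcal F$ is the four-dimensional Fock space with basis $1,\psi_1,\psi_2,\psi_1\psi_2$, and $$\pi=-i\,\partial/\partial\phi,\qquad \bar\pi=-i\,\partial/\partial\bar\phi,\qquad \bar\psi^\alpha=\partial/\partial\psi_\alpha .$$ Put $$H=\bar\pi\pi+\bar\phi\phi+\tfrac12\sum_{\alpha}(\psi_\alpha\bar\psi^\alpha-\bar\psi^\alpha\psi_\alpha),\quad L=i(\phi\pi-\bar\phi\bar\pi),\quad F=\sum_\alpha\psi_\alpha\bar\psi^\alpha,\quad K=L+F,$$ and, for real $\lambda$, let $H_\lambda=H+\lambda K$, as the closure of this operator on Schwartz functions (Römelsberger's complex weak supersymmetric model). Then: 1. $H_\lambda$ is self-adjoint for every real $\lambda$. There is one orthonormal Hilbert basis $\Psi_{n,l,s}$ ($n=0,1,2,\dots$; $l\in\mathbb{Z}$; $s\subseteq\{1,2\}$) of Schwartz functions such that, for every real $\lambda$, $L\Psi_{n,l,s}=l\,\Psi_{n,l,s}$,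 $F\Psi_{n,l,s}=|s|\,\Psi_{n,l,s}$, and $H_\lambda\Psi_{n,l,s}=E\,\Psi_{n,l,s}$ with $$E=2n+|l|+|s|+\lambda(l+|s|).$$ 2. Let $-1<\lambda<1$ and $\beta>0$. Then $e^{-\beta H_\lambda}$ exists as a bounded operator (the semigroup generated by $-H_\lambda$), $(-1)^Fe^{-\beta H_\lambda}$ is of trace class, and the index is $$\operatorname{Tr}\{(-1)^Fe^{-\beta H_\lambda}\}=\bigl(1-e^{-\beta(1+\lambda)}\bigr)\sum_{m=0}^\infty e^{-m\beta(1-\lambda)}=\frac{1-e^{-\beta(1+\lambda)}}{1-e^{-\beta(1-\lambda)}} .$$ 3. For $\beta>0$, an integer $n\ge2$ and $\lambda=1-2/n$, the index equals $\sum_{m=0}^{n-2}e^{-2\beta m/n}$; for $n=3$ (that is, $\lambda=1/3$) it equals $1+e^{-2\beta/3}$. -/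

import Mathlib

open MeasureTheory SchwartzMap Filter Topology
open scoped Matrix ComplexConjugate ComplexInnerProductSpace LineDeriv

noncomputable section

namespace WeakSusy

/-! ### The fermionic sector -/

/-- The fermionic Fock space of two fermions: polynomials in the anticommuting variables
`ψ 0, ψ 1`. The orthonormal basis vector attached to `s ⊆ {0, 1}` is the product, in increasing
order, of the `ψ α` with `α ∈ s`. -/
abbrev Fock : Type := EuclideanSpace ℂ (Finset (Fin 2))

/-- Left multiplication by the anticommuting variable `ψ α`, as a matrix in the monomial basis:
the monomial of `t` goes to `± ` the monomial of `t ∪ {α}` if `α ∉ t`, and to `0` otherwise. -/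
def psiMat (α : Fin 2) : Matrix (Finset (Fin 2)) (Finset (Fin 2)) ℂ :=
  Matrix.of fun s t =>
    if α ∉ t ∧ s = insert α t then (-1) ^ (t.filter fun γ => γ < α).card else 0

/-- The conjugate operator `∂ / ∂ψ α`, the adjoint of multiplication by `ψ α`. -/
def psiBarMat (α : Fin 2) : Matrix (Finset (Fin 2)) (Finset (Fin 2)) ℂ := (psiMat α)ᴴ

/-- The fermion parity `(-1)^F`, equal to `(-1)^k` on monomials of degree `k`. -/
def parityMat : Matrix (Finset (Fin 2)) (Finset (Fin 2)) ℂ :=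
  Matrix.diagonal fun s => (-1) ^ s.card

/-! ### Operators on smooth, rapidly decreasing states -/

/-- Schwartz wave functions of the complex variable `φ` with values in the Fock space. -/
abbrev SchwartzState : Type := 𝓢(ℂ, Fock)

/-- Operators on Schwartz states; the product is composition. -/
abbrev Op : Type := SchwartzState →L[ℂ] SchwartzState

/-- A matrix on the Fock space acting pointwise on wave functions. -/
def fermionOp (M : Matrix (Finset (Fin 2)) (Finset (Fin 2)) ℂ) : Op :=
  SchwartzMap.postcompCLM (Matrix.toEuclideanCLM (𝕜 := ℂ) M)

/-- The operator `ψ α`. -/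
def psi (α : Fin 2) : Op := fermionOp (psiMat α)

/-- The operator `∂ / ∂ψ α`. -/
def psiBar (α : Fin 2) : Op := fermionOp (psiBarMat α)

/-- Multiplication by `φ`. -/
def phi : Op := SchwartzMap.smulLeftCLM Fock (fun z : ℂ => z)

/-- Multiplication by the complex conjugate of `φ`. -/
def phiBar : Op := SchwartzMap.smulLeftCLM Fock (fun z : ℂ => conj z)

/-- The derivative `∂ / ∂x` in the real part of `φ = x + i y`. -/
def dx : Op := LineDeriv.lineDerivOpCLM ℂ SchwartzState (1 : ℂ)

/-- The derivative `∂ / ∂y` in the imaginary part of `φ = x + i y`. -/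
def dy : Op := LineDeriv.lineDerivOpCLM ℂ SchwartzState Complex.I

/-- `π = -i ∂ / ∂φ`, with the Wirtinger derivative `∂ / ∂φ = (∂ / ∂x - i ∂ / ∂y) / 2`. -/
def mom : Op := (-Complex.I) • ((1 / 2 : ℂ) • (dx - Complex.I • dy))

/-- `-i ∂ / ∂(conj φ)`, with `∂ / ∂(conj φ) = (∂ / ∂x + i ∂ / ∂y) / 2`. -/
def momBar : Op := (-Complex.I) • ((1 / 2 : ℂ) • (dx + Complex.I • dy))

/-- The Hamiltonian `H` of the complex model. -/
def ham : Op :=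
  momBar * mom + phiBar * phi
    + (1 / 2 : ℂ) • ∑ α : Fin 2, (psi α * psiBar α - psiBar α * psi α)

/-- The angular momentum `L = i (φ π - conj φ conj π)`. -/
def angMom : Op := Complex.I • (phi * mom - phiBar * momBar)

/-- The fermion charge `F`. -/
def fermionCharge : Op := ∑ α : Fin 2, psi α * psiBar α

/-- The conserved charge `K = L + F`. -/
def chargeK : Op := angMom + fermionCharge

/-- `H_λ = H + λ K` on Schwartz states. -/
def hamLam (lam : ℝ) : Op := ham + (lam : ℂ) • chargeK

/-! ### Operators on the Hilbert space -/

/-- The Hilbert space of states. -/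
abbrev Hilb : Type := Lp Fock 2 (volume : Measure ℂ)

/-- The inclusion of Schwartz states in the Hilbert space. -/
def toHilb : SchwartzState →ₗ[ℂ] Hilb :=
  (SchwartzMap.toLpCLM ℂ Fock 2 (volume : Measure ℂ)).toLinearMap

theorem toHilb_injective : Function.Injective toHilb :=
  SchwartzMap.injective_toLp 2 (volume : Measure ℂ)

/-- An operator on Schwartz states, as a partially defined operator on the Hilbert space. -/
def toPMap (T : Op) : Hilb →ₗ.[ℂ] Hilb where
  domain := LinearMap.range toHilb
  toFun := toHilb ∘ₗ T.toLinearMap ∘ₗ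
    (LinearEquiv.ofInjective toHilb toHilb_injective).symm.toLinearMap

/-- The Hamiltonian `H_λ` as an unbounded operator on the Hilbert space: the closure of its
restriction to Schwartz states. -/
def hamiltonian (lam : ℝ) : Hilb →ₗ.[ℂ] Hilb := (toPMap (hamLam lam)).closure

/-- The fermion parity `(-1)^F` on the Hilbert space. -/
def parity : Hilb →L[ℂ] Hilb :=
  ContinuousLinearMap.compLpL 2 (volume : Measure ℂ) (Matrix.toEuclideanCLM (𝕜 := ℂ) parityMat)

/-! ### The index -/

section Index

variable {E : Type} [NormedAddCommGroup E] [InnerProductSpace ℂ E]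

/-- `S t = e^{-t A}` for `t ≥ 0`: `S` is a strongly continuous one-parameter semigroup whose
infinitesimal generator is exactly `-A`, domain included. -/
structure IsExpSemigroup (A : E →ₗ.[ℂ] E) (S : ℝ → E →L[ℂ] E) : Prop where
  map_zero : S 0 = 1
  map_add : ∀ s t : ℝ, 0 ≤ s → 0 ≤ t → S (s + t) = S s * S t
  tendsto_zero : ∀ x : E, Tendsto (fun t : ℝ => S t x) (𝓝[>] 0) (𝓝 x)
  generator : ∀ x y : E, (x, y) ∈ A.graph ↔
    Tendsto (fun t : ℝ => ((t : ℂ)⁻¹) • (S t x - x)) (𝓝[>] 0) (𝓝 (-y))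

/-- `T` is of trace class with trace `c`: in every orthonormal Hilbert basis the diagonal matrix
elements are summable (unconditionally, hence absolutely, which is equivalent to `T` being of
trace class) with sum `c`. -/
def HasTrace (T : E →L[ℂ] E) (c : ℂ) : Prop :=
  ∀ (ι : Type) (b : HilbertBasis ι ℂ E), HasSum (fun i => ⟪b i, T (b i)⟫) c

end Index

/-- The Witten index `Tr ((-1)^F e^{-β A})` of the Hamiltonian `A` exists and equals `c`. -/
def HasWittenIndex (A : Hilb →ₗ.[ℂ] Hilb) (β : ℝ) (c : ℂ) : Prop :=
  ∃ S : ℝ → Hilb →L[ℂ] Hilb, IsExpSemigroup A S ∧ HasTrace (parity * S β) c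

end WeakSusy

end

/-!
The bosonic Hamiltonian is a pair of harmonic oscillators. With `∂ = ∂/∂φ` and
`∂' = ∂/∂(conj φ)`, the operators `annA = φ + ∂'`, `creA = conj φ - ∂`, `annB = conj φ + ∂` and
`creB = φ - ∂'` satisfy `[annA, creA] = [annB, creB] = 2` while the two pairs commute, and
`H = (creA annA + creB annB) / 2 + F`, `L = (creB annB - creA annA) / 2` (`ham_eq`, `angMom_eq`).
The creation operators applied to the Gaussian times a fermion monomial therefore give joint
eigenstates; with `j` and `k` quanta and fermion content `s`, the eigenvalue of `L` is `k - j` and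
that of `H_λ` is `j (1 - λ) + (k + |s|) (1 + λ)`.

The eigenstates are orthogonal because they are separated by the symmetric operators `creA annA`,
`creB annB` and the fermionic projections. They are complete: multiplication by `φ` or `conj φ`
is a combination of ladder operators, so their span contains every power of a real linear form
times the Gaussian. A function `f` orthogonal to the span thus has the property that `f` times the
Gaussian has vanishing moments; expanding the exponential shows that its Fourier transform vanishes
(`ae_eq_zero_of_moments_eq_zero`, `orthogonal_span_unitState`).

The rest is the theory of an operator diagonal in a Hilbert basis. The closure of a symmetric
operator with a Hilbert basis of eigenvectors in its domain is the maximal diagonal operator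
(`graph_closure_eq_diagGraph`), which is self-adjoint, and for non-negative eigenvalues generates
the diagonal contraction semigroup (`isExpSemigroup_diagSemigroup`): on the domain, the difference
quotient is a family of diagonal contractions tending strongly to the identity. The trace in any
basis is the sum of the eigenvalues (`hasTrace_of_basis`). With `x = exp (-β (1 - λ))` and
`y = exp (-β (1 + λ))` this sum is `(1 - x)⁻¹ (1 - y)⁻¹ (1 - y)²`, the last factor coming from the
two fermions (`hasSum_index`). For `λ = 1 - 2 / n` one has `y = x ^ (n - 1)`, which leaves a finite
geometric sum.
-/

noncomputable section

namespace WeakSusy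

/-! ### Operators diagonal in a Hilbert basis -/

section Diagonal

variable {E ι : Type} [NormedAddCommGroup E] [InnerProductSpace ℂ E]

theorem ext_inner_basis (b : HilbertBasis ι ℂ E) {x y : E} (h : ∀ i, ⟪b i, x⟫ = ⟪b i, y⟫) :
    x = y := by
  apply b.repr.injective
  ext i
  simpa only [b.repr_apply_apply] using h i

theorem hasSum_normSq_inner (b : HilbertBasis ι ℂ E) (x : E) :
    HasSum (fun i => ‖⟪b i, x⟫‖ ^ 2) (‖x‖ ^ 2) := by
  have h := b.hasSum_inner_mul_inner x x
  rw [inner_self_eq_norm_sq_to_K] at h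
  rw [← Complex.hasSum_ofReal, Complex.ofReal_pow]
  refine h.congr_fun fun i => ?_
  rw [← inner_conj_symm x (b i), Complex.conj_mul', Complex.ofReal_pow]

/-- Coordinates of `x` multiplied by a bounded sequence are again square summable. -/
theorem memℓp_mul_repr (b : HilbertBasis ι ℂ E) {c : ι → ℂ} (hc : ∀ i, ‖c i‖ ≤ 1) (x : E) :
    Memℓp (fun i => c i * b.repr x i) 2 := by
  refine Memℓp.mono' (lp.memℓp (b.repr x)) fun i => ?_
  rw [norm_mul]
  exact mul_le_of_le_one_left (norm_nonneg _) (hc i)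

/-- The contraction that is diagonal in the Hilbert basis `b`, with eigenvalues `c i` in the
closed unit disc. -/
def diagOp (b : HilbertBasis ι ℂ E) (c : ι → ℂ) (hc : ∀ i, ‖c i‖ ≤ 1) : E →L[ℂ] E :=
  LinearMap.mkContinuous
    { toFun := fun x => b.repr.symm ⟨fun i => c i * b.repr x i, memℓp_mul_repr b hc x⟩
      map_add' := fun x y => by
        rw [← map_add]
        congr 1
        ext i
        simp only [map_add]
        exact mul_add _ _ _
      map_smul' := fun a x => by
        rw [RingHom.id_apply, ← map_smul]
        congr 1
        ext i
        simp [mul_left_comm] } 1 (fun x => by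
      rw [one_mul, LinearMap.coe_mk, AddHom.coe_mk, LinearIsometryEquiv.norm_map,
        ← b.repr.norm_map x]
      refine lp.norm_mono two_ne_zero fun i => ?_
      rw [norm_mul]
      exact mul_le_of_le_one_left (norm_nonneg _) (hc i))

theorem inner_diagOp (b : HilbertBasis ι ℂ E) {c : ι → ℂ} (hc : ∀ i, ‖c i‖ ≤ 1) (i : ι) (x : E) :
    ⟪b i, diagOp b c hc x⟫ = c i * ⟪b i, x⟫ := by
  rw [← b.repr_apply_apply, ← b.repr_apply_apply]
  simp [diagOp]

theorem diagOp_basis (b : HilbertBasis ι ℂ E) {c : ι → ℂ} (hc : ∀ i, ‖c i‖ ≤ 1) (i : ι) :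
    diagOp b c hc (b i) = c i • b i := by
  refine ext_inner_basis b fun j => ?_
  rw [inner_diagOp, inner_smul_right]
  obtain rfl | h := eq_or_ne j i
  · rfl
  · rw [b.orthonormal.2 h, mul_zero, mul_zero]

/-- Diagonal contractions whose eigenvalues converge to `1` one by one converge strongly to the
identity. -/
theorem tendsto_diagOp {α : Type*} {l : Filter α} (b : HilbertBasis ι ℂ E) {c : α → ι → ℂ}
    (hc : ∀ a i, ‖c a i‖ ≤ 1) (h : ∀ i, Tendsto (fun a => c a i) l (𝓝 1)) (x : E) :
    Tendsto (fun a => diagOp b (c a) (hc a) x) l (𝓝 x) := by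
  rw [tendsto_iff_norm_sub_tendsto_zero]
  have key : Tendsto (fun a => ∑' i, ‖(c a i - 1) * ⟪b i, x⟫‖ ^ 2) l (𝓝 (∑' _ : ι, (0 : ℝ))) := by
    refine tendsto_tsum_of_dominated_convergence
      (bound := fun i => 4 * ‖⟪b i, x⟫‖ ^ 2) ((hasSum_normSq_inner b x).summable.mul_left 4)
      (fun i => ?_) (Eventually.of_forall fun a i => ?_)
    · have := ((((h i).sub_const 1).mul_const ⟪b i, x⟫).norm).pow 2
      simpa using this
    · have h2 : ‖c a i - 1‖ ≤ 2 := by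
        calc ‖c a i - 1‖ ≤ ‖c a i‖ + ‖(1 : ℂ)‖ := norm_sub_le _ _
          _ ≤ 2 := by rw [norm_one]; linarith [hc a i]
      rw [Real.norm_of_nonneg (by positivity), norm_mul, mul_pow]
      have : ‖c a i - 1‖ ^ 2 ≤ 2 ^ 2 := by gcongr
      nlinarith [sq_nonneg ‖⟪b i, x⟫‖]
  rw [tsum_zero] at key
  have h3 := (Real.continuous_sqrt.tendsto 0).comp key
  rw [Real.sqrt_zero] at h3
  refine h3.congr fun a => ?_
  have h4 := (hasSum_normSq_inner b (diagOp b (c a) (hc a) x - x)).tsum_eq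
  rw [Function.comp_apply, ← Real.sqrt_sq (norm_nonneg (diagOp b (c a) (hc a) x - x)), ← h4]
  congr 1
  refine tsum_congr fun i => ?_
  rw [inner_sub_right, inner_diagOp, sub_mul, one_mul]

/-- The graph of the maximal operator that is diagonal in the Hilbert basis `b`, with real
eigenvalues `μ i`. -/
def diagGraph (b : HilbertBasis ι ℂ E) (μ : ι → ℝ) : Submodule ℂ (E × E) where
  carrier := {p | ∀ i, ⟪b i, p.2⟫ = μ i * ⟪b i, p.1⟫}
  add_mem' := fun {p q} hp hq i => by
    simp only [Set.mem_ofPred_eq] at hp hq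
    rw [Prod.snd_add, Prod.fst_add, inner_add_right, inner_add_right, hp, hq, mul_add]
  zero_mem' := fun i => by simp
  smul_mem' := fun a p hp i => by
    simp only [Set.mem_ofPred_eq] at hp
    rw [Prod.smul_snd, Prod.smul_fst, inner_smul_right, inner_smul_right, hp, mul_left_comm]

theorem mem_diagGraph {b : HilbertBasis ι ℂ E} {μ : ι → ℝ} {p : E × E} :
    p ∈ diagGraph b μ ↔ ∀ i, ⟪b i, p.2⟫ = μ i * ⟪b i, p.1⟫ := Iff.rfl

theorem isClosed_diagGraph (b : HilbertBasis ι ℂ E) (μ : ι → ℝ) :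
    IsClosed (diagGraph b μ : Set (E × E)) := by
  have : (diagGraph b μ : Set (E × E)) = ⋂ i, {p | ⟪b i, p.2⟫ = μ i * ⟪b i, p.1⟫} := by
    ext p
    simp [mem_diagGraph]
  rw [this]
  exact isClosed_iInter fun i => isClosed_eq (by fun_prop) (by fun_prop)

theorem diagGraph_toLinearPMap_graph (b : HilbertBasis ι ℂ E) (μ : ι → ℝ) :
    (diagGraph b μ).toLinearPMap.graph = diagGraph b μ := by
  refine Submodule.toLinearPMap_graph_eq _ fun p hp h0 => ext_inner_basis b fun i => ?_
  rw [mem_diagGraph.1 hp i, h0, inner_zero_right, mul_zero]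

theorem basis_mem_diagGraph (b : HilbertBasis ι ℂ E) (μ : ι → ℝ) (i : ι) :
    (b i, (μ i : ℂ) • b i) ∈ diagGraph b μ := by
  refine mem_diagGraph.2 fun j => ?_
  rw [inner_smul_right]
  obtain rfl | h := eq_or_ne j i
  · rfl
  · simp [b.orthonormal.2 h]

/-- Every pair in the diagonal graph is the limit of its partial sums along the basis. -/
theorem diagGraph_le_closure {b : HilbertBasis ι ℂ E} {μ : ι → ℝ} {G : Submodule ℂ (E × E)}
    (hb : ∀ i, (b i, (μ i : ℂ) • b i) ∈ G) : diagGraph b μ ≤ G.topologicalClosure := by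
  intro p hp
  have h1 := b.hasSum_repr p.1
  have h2 := b.hasSum_repr p.2
  have h3 : HasSum (fun i => b.repr p.1 i • (b i, (μ i : ℂ) • b i)) p := by
    refine (h1.prodMk h2).congr_fun fun i => ?_
    rw [b.repr_apply_apply, b.repr_apply_apply, mem_diagGraph.1 hp i, Prod.smul_mk, smul_smul,
      mul_comm (μ i : ℂ)]
  exact mem_closure_of_tendsto h3
    (Eventually.of_forall fun s => G.sum_mem fun i _ => G.smul_mem _ (hb i))

/-- A symmetric operator whose domain contains a Hilbert basis of eigenvectors has the maximal
diagonal operator as its closure. -/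
theorem graph_closure_eq_diagGraph {A : E →ₗ.[ℂ] E} {b : HilbertBasis ι ℂ E} {μ : ι → ℝ}
    (hb : ∀ i, (b i, (μ i : ℂ) • b i) ∈ A.graph) (hA : A.graph ≤ diagGraph b μ) :
    A.closure.graph = diagGraph b μ := by
  have hcl : A.IsClosable := by
    refine LinearPMap.isClosable_iff_exists_closed_extension.2
      ⟨(diagGraph b μ).toLinearPMap, ?_, LinearPMap.le_of_le_graph ?_⟩
    · rw [LinearPMap.IsClosed, diagGraph_toLinearPMap_graph]
      exact isClosed_diagGraph b μ
    · rwa [diagGraph_toLinearPMap_graph]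
  rw [← hcl.graph_closure_eq_closure_graph]
  exact le_antisymm (Submodule.topologicalClosure_minimal _ hA (isClosed_diagGraph b μ))
    (diagGraph_le_closure hb)

theorem isSelfAdjoint_of_graph_eq_diagGraph [CompleteSpace E] {A : E →ₗ.[ℂ] E}
    {b : HilbertBasis ι ℂ E} {μ : ι → ℝ} (hA : A.graph = diagGraph b μ) : IsSelfAdjoint A := by
  have hdense : Dense (A.domain : Set E) := by
    have hle : Submodule.span ℂ (Set.range b) ≤ A.domain := by
      rw [Submodule.span_le]
      rintro _ ⟨i, rfl⟩
      have h := basis_mem_diagGraph b μ i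
      rw [← hA] at h
      exact LinearPMap.mem_domain_of_mem_graph h
    have : Dense (Submodule.span ℂ (Set.range b) : Set E) := by
      rw [Submodule.dense_iff_topologicalClosure_eq_top]
      exact b.dense_span
    exact this.mono hle
  rw [LinearPMap.isSelfAdjoint_def]
  apply LinearPMap.eq_of_eq_graph
  rw [LinearPMap.adjoint_graph_eq_graph_adjoint hdense, hA]
  ext p
  rw [Submodule.mem_adjoint_iff]
  constructor
  · intro h
    refine mem_diagGraph.2 fun i => ?_
    have h1 := h _ _ (basis_mem_diagGraph b μ i)
    rw [inner_smul_left, Complex.conj_ofReal, sub_eq_zero] at h1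
    exact h1.symm
  · intro h x y hxy
    rw [sub_eq_zero, ← b.tsum_inner_mul_inner y, ← b.tsum_inner_mul_inner x]
    refine tsum_congr fun i => ?_
    rw [mem_diagGraph.1 h i, ← inner_conj_symm y, ← inner_conj_symm x, mem_diagGraph.1 hxy i]
    simp
    ring

/-! ### The semigroup of a non-negative diagonal operator -/

theorem norm_exp_neg_le_one {t a : ℝ} (ht : 0 ≤ t) (ha : 0 ≤ a) :
    ‖(Real.exp (-(t * a)) : ℂ)‖ ≤ 1 := by
  rw [Complex.norm_real, Real.norm_of_nonneg (Real.exp_pos _).le, Real.exp_le_one_iff]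
  have := mul_nonneg ht ha
  linarith

/-- The contraction semigroup with eigenvalues `exp (-t μ i)`, extended by the identity to
negative times. -/
def diagSemigroup (b : HilbertBasis ι ℂ E) (μ : ι → ℝ) (hμ : ∀ i, 0 ≤ μ i) (t : ℝ) : E →L[ℂ] E :=
  diagOp b (fun i => (Real.exp (-(max t 0 * μ i)) : ℂ))
    fun i => norm_exp_neg_le_one (le_max_right _ _) (hμ i)

theorem inner_diagSemigroup {b : HilbertBasis ι ℂ E} {μ : ι → ℝ} (hμ : ∀ i, 0 ≤ μ i) {t : ℝ}
    (ht : 0 ≤ t) (i : ι) (x : E) :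
    ⟪b i, diagSemigroup b μ hμ t x⟫ = (Real.exp (-(t * μ i)) : ℂ) * ⟪b i, x⟫ := by
  rw [diagSemigroup, inner_diagOp, max_eq_left ht]

theorem diagSemigroup_basis {b : HilbertBasis ι ℂ E} {μ : ι → ℝ} (hμ : ∀ i, 0 ≤ μ i) {t : ℝ}
    (ht : 0 ≤ t) (i : ι) :
    diagSemigroup b μ hμ t (b i) = (Real.exp (-(t * μ i)) : ℂ) • b i := by
  rw [diagSemigroup, diagOp_basis, max_eq_left ht]

/-- The difference quotient `(1 - exp (-u)) / u` of the exponential at the origin. -/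
def expQuot (u : ℝ) : ℝ := if u = 0 then 1 else (1 - Real.exp (-u)) / u

theorem expQuot_mul (u : ℝ) : expQuot u * u = 1 - Real.exp (-u) := by
  unfold expQuot
  split_ifs with h
  · simp [h]
  · field_simp

theorem norm_expQuot_le_one {u : ℝ} (hu : 0 ≤ u) : ‖(expQuot u : ℂ)‖ ≤ 1 := by
  rw [Complex.norm_real, expQuot]
  split_ifs with h
  · simp
  · have hu' : 0 < u := lt_of_le_of_ne hu (Ne.symm h)
    have h1 : Real.exp (-u) ≤ 1 := by simpa using hu
    have h2 := Real.add_one_le_exp (-u)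
    rw [Real.norm_of_nonneg (div_nonneg (by linarith) hu), div_le_one hu']
    linarith

theorem tendsto_exp_neg_slope (a : ℝ) :
    Tendsto (fun t : ℝ => t⁻¹ * (Real.exp (-(t * a)) - 1)) (𝓝[>] 0) (𝓝 (-a)) := by
  have h : HasDerivAt (fun t : ℝ => Real.exp (-(t * a))) (-a) 0 := by
    have := (((hasDerivAt_id (0 : ℝ)).mul_const a).neg).exp
    simpa using this
  have h2 := h.tendsto_slope_zero_right
  simpa using h2

theorem tendsto_expQuot (a : ℝ) :
    Tendsto (fun t : ℝ => (expQuot (max t 0 * a) : ℂ)) (𝓝[>] 0) (𝓝 1) := by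
  rw [← Complex.ofReal_one]
  refine (Complex.continuous_ofReal.tendsto 1).comp ?_
  obtain rfl | ha := eq_or_ne a 0
  · simp [expQuot]
  · have h := (tendsto_exp_neg_slope a).mul_const (-a⁻¹)
    rw [neg_mul_neg, mul_inv_cancel₀ ha] at h
    refine h.congr' ?_
    filter_upwards [self_mem_nhdsWithin] with t ht
    have ht' : (0 : ℝ) < t := ht
    rw [max_eq_left ht'.le, expQuot, if_neg (mul_ne_zero ht'.ne' ha)]
    field_simp
    ring

theorem isExpSemigroup_diagSemigroup {A : E →ₗ.[ℂ] E} {b : HilbertBasis ι ℂ E} {μ : ι → ℝ}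
    (hA : A.graph = diagGraph b μ) (hμ : ∀ i, 0 ≤ μ i) :
    IsExpSemigroup A (diagSemigroup b μ hμ) where
  map_zero := by
    ext x
    refine ext_inner_basis b fun i => ?_
    rw [inner_diagSemigroup hμ le_rfl]
    simp
  map_add := fun s t hs ht => by
    ext x
    refine ext_inner_basis b fun i => ?_
    rw [mul_apply_eq_comp, inner_diagSemigroup hμ (add_nonneg hs ht),
      inner_diagSemigroup hμ hs, inner_diagSemigroup hμ ht, ← mul_assoc, ← Complex.ofReal_mul,
      ← Real.exp_add]
    congr 3
    ring
  tendsto_zero := fun x => by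
    refine tendsto_diagOp b (fun t i => norm_exp_neg_le_one (le_max_right _ _) (hμ i))
      (fun i => ?_) x
    have hcont : Continuous fun t : ℝ => (Real.exp (-(max t 0 * μ i)) : ℂ) := by fun_prop
    have h := (hcont.tendsto 0).mono_left (nhdsWithin_le_nhds (s := Set.Ioi 0))
    simpa using h
  generator := fun x y => by
    rw [hA]
    constructor
    · intro h
      -- on the domain, the difference quotient is a diagonal contraction applied to `-y`
      have hq : ∀ t : ℝ, ∀ i, ‖(expQuot (max t 0 * μ i) : ℂ)‖ ≤ 1 := fun t i =>
        norm_expQuot_le_one (mul_nonneg (le_max_right _ _) (hμ i))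
      have h1 := tendsto_diagOp b hq (fun i => tendsto_expQuot (μ i)) (-y)
      refine h1.congr' ?_
      filter_upwards [self_mem_nhdsWithin] with t ht
      have ht' : (0 : ℝ) < t := ht
      have htc : (t : ℂ) ≠ 0 := by exact_mod_cast ht'.ne'
      refine ext_inner_basis b fun i => ?_
      rw [inner_diagOp, inner_smul_right, inner_sub_right, inner_diagSemigroup hμ ht'.le,
        inner_neg_right, mem_diagGraph.1 h i, max_eq_left ht'.le]
      have h2 : (expQuot (t * μ i) : ℂ) * (t * μ i) = 1 - (Real.exp (-(t * μ i)) : ℂ) := by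
        exact_mod_cast expQuot_mul (t * μ i)
      rw [eq_inv_mul_iff_mul_eq₀ htc]
      linear_combination (-⟪b i, x⟫) * h2
    · intro h
      refine mem_diagGraph.2 fun i => ?_
      have h1 : Tendsto (fun t : ℝ => ⟪b i, ((t : ℂ)⁻¹) • (diagSemigroup b μ hμ t x - x)⟫)
          (𝓝[>] 0) (𝓝 ⟪b i, -y⟫) := tendsto_const_nhds.inner h
      have h2 : Tendsto (fun t : ℝ => ((t⁻¹ * (Real.exp (-(t * μ i)) - 1) : ℝ) : ℂ) * ⟪b i, x⟫)
          (𝓝[>] 0) (𝓝 (((-μ i : ℝ) : ℂ) * ⟪b i, x⟫)) :=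
        ((Complex.continuous_ofReal.tendsto _).comp (tendsto_exp_neg_slope (μ i))).mul_const _
      have h3 := tendsto_nhds_unique (h1.congr' ?_) h2
      · rw [inner_neg_right] at h3
        push_cast at h3
        linear_combination -h3
      · filter_upwards [self_mem_nhdsWithin] with t ht
        have ht' : (0 : ℝ) < t := ht
        rw [inner_smul_right, inner_sub_right, inner_diagSemigroup hμ ht'.le]
        push_cast
        ring

/-! ### The trace of a diagonal operator -/

/-- An operator with a Hilbert basis of eigenvectors and absolutely summable eigenvalues is of
trace class. In another basis `e` the sum of `c i |⟪e k, b i⟫|²` over all pairs converges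
absolutely, so it may be carried out in either order. -/
theorem hasTrace_of_basis {T : E →L[ℂ] E} {b : HilbertBasis ι ℂ E} {c : ι → ℂ} {a : ℂ}
    (hT : ∀ i, T (b i) = c i • b i) (hc : HasSum c a) : HasTrace T a := by
  intro κ e
  have hcs : Summable fun i => ‖c i‖ := hc.summable.norm
  have hpar : ∀ i, HasSum (fun k => ‖⟪e k, b i⟫‖ ^ 2) 1 := fun i => by
    simpa [b.orthonormal.1 i] using hasSum_normSq_inner e (b i)
  let f : ι × κ → ℂ := fun p => c p.1 * ((‖⟪e p.2, b p.1⟫‖ ^ 2 : ℝ) : ℂ)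
  have hfi : ∀ i, HasSum (fun k => f (i, k)) (c i) := fun i => by
    have := ((Complex.hasSum_ofReal.2 (hpar i)).mul_left (c i))
    simpa [f] using this
  have hf : Summable f := by
    refine Summable.of_norm ?_
    have hn : ∀ i k, ‖f (i, k)‖ = ‖c i‖ * ‖⟪e k, b i⟫‖ ^ 2 := fun i k => by
      simp [f]
    refine (summable_prod_of_nonneg fun p => norm_nonneg _).2 ⟨fun i => ?_, ?_⟩
    · simp only [hn]
      exact (hpar i).summable.mul_left _
    · simp only [hn, tsum_mul_left, (hpar _).tsum_eq, mul_one]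
      exact hcs
  have hfa : HasSum f a := by
    have h1 := hf.hasSum.prod_fiberwise hfi
    rw [← h1.unique hc]
    exact hf.hasSum
  have hfk : HasSum (f ∘ Prod.swap) a := (Equiv.prodComm κ ι).hasSum_iff.2 hfa
  refine hfk.prod_fiberwise fun k => ?_
  have h1 := (b.hasSum_repr (e k)).mapL T
  have h2 := h1.mapL (innerSL ℂ (e k))
  refine h2.congr_fun fun i => ?_
  rw [map_smul, hT, map_smul, map_smul, innerSL_apply_apply, b.repr_apply_apply]
  simp only [f, Function.comp_apply, Prod.swap_prod_mk, smul_eq_mul]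
  rw [Complex.ofReal_pow, ← Complex.conj_mul', inner_conj_symm]
  ring

end Diagonal

/-! ### Gaussians -/

/-- Polynomial times Gaussian is bounded. -/
theorem one_add_pow_mul_exp_neg_sq_le {c : ℝ} (hc : 0 < c) (m : ℕ) {r : ℝ} (hr : 0 ≤ r) :
    (1 + r) ^ m * Real.exp (-(c * r ^ 2)) ≤ m.factorial * Real.exp (1 + c⁻¹) := by
  have h1 : (1 + r) ^ m ≤ m.factorial * Real.exp (1 + r) := by
    have := Real.pow_div_factorial_le_exp (1 + r) (by linarith) m
    rwa [div_le_iff₀' (by positivity)] at this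
  have h2 : r - c * r ^ 2 ≤ c⁻¹ := by
    have h3 : c * (c⁻¹ - (r - c * r ^ 2)) = 1 - c * r + (c * r) ^ 2 := by
      field_simp
      ring
    have h4 : 0 ≤ c * (c⁻¹ - (r - c * r ^ 2)) := by
      rw [h3]; nlinarith [sq_nonneg (c * r - 1), sq_nonneg (c * r)]
    linarith [nonneg_of_mul_nonneg_right h4 hc]
  calc (1 + r) ^ m * Real.exp (-(c * r ^ 2))
      ≤ m.factorial * Real.exp (1 + r) * Real.exp (-(c * r ^ 2)) := by gcongr
    _ = m.factorial * Real.exp (1 + (r - c * r ^ 2)) := by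
      rw [mul_assoc, ← Real.exp_add]; ring_nf
    _ ≤ _ := by gcongr

/-- The Gaussian `exp (-c |z|²)` as a Schwartz function. The `n`-th derivative of the composition
with the exponential is bounded by the Gaussian itself times a polynomial. -/
def gaussian (c : ℝ) (hc : 0 < c) : 𝓢(ℂ, ℝ) where
  toFun z := Real.exp (-(c * ‖z‖ ^ 2))
  smooth' := by
    have : ContDiff ℝ (⊤ : ℕ∞) fun z : ℂ => ‖z‖ ^ 2 := contDiff_norm_sq ℝ
    fun_prop
  decay' k n := by
    have hq : (fun z : ℂ => -(c * ‖z‖ ^ 2)).HasTemperateGrowth := by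
      have := Function.hasTemperateGrowth_norm_sq (H := ℂ)
      fun_prop
    obtain ⟨m, C, hC, h⟩ := hq.norm_iteratedFDeriv_le_uniform n
    refine ⟨n.factorial * (1 + C) ^ n * ((k + m * n).factorial * Real.exp (1 + c⁻¹)),
      fun z => ?_⟩
    have hz : 1 ≤ 1 + ‖z‖ := by linarith [norm_nonneg z]
    have h1 : ∀ i, 1 ≤ i → i ≤ n →
        ‖iteratedFDeriv ℝ i (fun z : ℂ => -(c * ‖z‖ ^ 2)) z‖ ≤ ((1 + C) * (1 + ‖z‖) ^ m) ^ i := by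
      intro i hi hin
      calc _ ≤ C * (1 + ‖z‖) ^ m := h i hin z
        _ ≤ (1 + C) * (1 + ‖z‖) ^ m := by gcongr; linarith
        _ ≤ _ := le_self_pow₀ (one_le_mul_of_one_le_of_one_le (by linarith) (one_le_pow₀ hz))
          (by omega)
    have h2 := norm_iteratedFDeriv_comp_le (n := n) Real.contDiff_exp hq.1 (by exact_mod_cast le_top)
      z (C := Real.exp (-(c * ‖z‖ ^ 2)))
      (fun i _ => by
        rw [norm_iteratedFDeriv_eq_norm_iteratedDeriv, iteratedDeriv_eq_iterate, Real.iter_deriv_exp,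
          Real.norm_of_nonneg (Real.exp_pos _).le]) h1
    calc ‖z‖ ^ k * ‖iteratedFDeriv ℝ n (fun z : ℂ => Real.exp (-(c * ‖z‖ ^ 2))) z‖
        ≤ (1 + ‖z‖) ^ k * (n.factorial * Real.exp (-(c * ‖z‖ ^ 2))
            * ((1 + C) * (1 + ‖z‖) ^ m) ^ n) := by
          gcongr
          · linarith
          · exact h2
      _ = n.factorial * (1 + C) ^ n
            * ((1 + ‖z‖) ^ (k + m * n) * Real.exp (-(c * ‖z‖ ^ 2))) := by
          rw [mul_pow, ← pow_mul, pow_add]; ring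
      _ ≤ _ := by
          exact mul_le_mul_of_nonneg_left
            (one_add_pow_mul_exp_neg_sq_le hc _ (norm_nonneg z)) (by positivity)

theorem gaussian_apply (c : ℝ) (hc : 0 < c) (z : ℂ) :
    gaussian c hc z = Real.exp (-(c * ‖z‖ ^ 2)) := rfl

/-- An `L²` function times the Gaussian has all exponential moments. -/
theorem integrable_exp_mul_gaussian_mul {f : ℂ → ℂ} (hf : MemLp f 2 volume) (c : ℝ) :
    Integrable fun z => Real.exp (c * ‖z‖) * ‖(gaussian 1 one_pos z : ℂ) * f z‖ := by
  have h1 : MemLp (gaussian (1 / 2) one_half_pos) 2 volume := SchwartzMap.memLp _ 2 volume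
  have h2 : Integrable fun z => gaussian (1 / 2) one_half_pos z * ‖f z‖ :=
    h1.integrable_mul hf.norm
  refine (h2.const_mul (Real.exp (c ^ 2 / 2))).mono' ?_ (Eventually.of_forall fun z => ?_)
  · refine AEStronglyMeasurable.mul (by fun_prop) ?_
    exact ((Complex.continuous_ofReal.comp
      (gaussian 1 one_pos).continuous).aestronglyMeasurable.mul hf.1).norm
  · rw [norm_mul, norm_norm, norm_mul, Real.norm_of_nonneg (Real.exp_pos _).le, Complex.norm_real,
      gaussian_apply, gaussian_apply, Real.norm_of_nonneg (Real.exp_pos _).le, ← mul_assoc,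
      ← mul_assoc, ← Real.exp_add, ← Real.exp_add]
    refine mul_le_mul_of_nonneg_right (Real.exp_le_exp.2 ?_) (norm_nonneg _)
    nlinarith [sq_nonneg (c - ‖z‖)]

/-! ### Functions determined by their moments -/

/-- Injectivity of the Fourier transform on integrable functions, by duality with Schwartz
functions. -/
theorem ae_eq_zero_of_fourier_eq_zero {h : ℂ → ℂ} (hh : Integrable h)
    (h0 : ∀ w, FourierTransform.fourier h w = 0) : h =ᵐ[volume] 0 := by
  refine ae_eq_zero_of_integral_contDiff_smul_eq_zero hh.locallyIntegrable fun g hg hgc => ?_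
  have hgc' : HasCompactSupport (fun z => (g z : ℂ)) := hgc.comp_left Complex.ofReal_zero
  let G : 𝓢(ℂ, ℂ) := hgc'.toSchwartzMap (Complex.ofRealCLM.contDiff.comp hg)
  have hG : ∀ z, G z = g z := fun z => rfl
  obtain ⟨K, hK⟩ : ∃ K : 𝓢(ℂ, ℂ), FourierTransform.fourier K = G :=
    ⟨FourierTransformInv.fourierInv G, FourierTransform.fourier_fourierInv_eq G⟩
  have key := VectorFourier.integral_fourierIntegral_smul_eq_flip (L := innerₗ ℂ)
    Real.continuous_fourierChar continuous_inner K.integrable hh (μ := volume) (ν := volume)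
  have e1 : ∀ w, VectorFourier.fourierIntegral Real.fourierChar volume (innerₗ ℂ) K w = g w := by
    intro w
    rw [← hG, ← hK]
    rfl
  have e2 : ∀ w, VectorFourier.fourierIntegral Real.fourierChar volume (innerₗ ℂ).flip h w = 0 := by
    intro w
    rw [flip_innerₗ]
    exact h0 w
  simp only [e1, e2, smul_zero, integral_zero] at key
  simpa using key

/-- A function with exponential moments is determined by its moments: expand the character in the
Fourier integral in its Taylor series. -/
theorem ae_eq_zero_of_moments_eq_zero {h : ℂ → ℂ} (hm : AEStronglyMeasurable h volume)
    (hexp : ∀ c : ℝ, Integrable fun z => Real.exp (c * ‖z‖) * ‖h z‖)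
    (h0 : ∀ (w : ℂ) (n : ℕ), ∫ z, ((inner ℝ z w : ℝ) : ℂ) ^ n * h z = 0) : h =ᵐ[volume] 0 := by
  have hh : Integrable h := by
    have := hexp 0
    simp only [zero_mul, Real.exp_zero, one_mul] at this
    exact (integrable_norm_iff hm).1 this
  refine ae_eq_zero_of_fourier_eq_zero hh fun w => ?_
  let a : ℂ := -(2 * Real.pi * Complex.I)
  let q : ℂ → ℂ := fun z => ((inner ℝ z w : ℝ) : ℂ)
  have ha : ‖a‖ = 2 * Real.pi := by
    simp [a, abs_of_pos Real.pi_pos]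
  have hsum : ∀ z, HasSum (fun n : ℕ => (a * q z) ^ n / n.factorial * h z)
      (Complex.exp (a * q z) * h z) := fun z => by
    refine HasSum.mul_right _ ?_
    rw [Complex.exp_eq_exp_ℂ]
    exact NormedSpace.expSeries_div_hasSum_exp (a * q z)
  have hbound : ∀ z, HasSum (fun n : ℕ => ‖a * q z‖ ^ n / n.factorial * ‖h z‖)
      (Real.exp ‖a * q z‖ * ‖h z‖) := fun z => by
    refine HasSum.mul_right _ ?_
    rw [Real.exp_eq_exp_ℝ]
    exact NormedSpace.expSeries_div_hasSum_exp ‖a * q z‖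
  have hqc : Continuous q := by fun_prop
  have key := hasSum_integral_of_dominated_convergence (μ := volume)
    (F := fun (n : ℕ) z => (a * q z) ^ n / n.factorial * h z)
    (f := fun z => Complex.exp (a * q z) * h z)
    (fun n z => ‖a * q z‖ ^ n / n.factorial * ‖h z‖)
    (fun n => AEStronglyMeasurable.mul (by fun_prop) hm)
    (fun n => Eventually.of_forall fun z => by simp)
    (Eventually.of_forall fun z => (hbound z).summable)
    (by
      simp only [(hbound _).tsum_eq]
      refine (hexp (2 * Real.pi * ‖w‖)).mono' (AEStronglyMeasurable.mul (by fun_prop) hm.norm)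
        (Eventually.of_forall fun z => ?_)
      rw [Real.norm_of_nonneg (by positivity)]
      gcongr
      rw [norm_mul, ha, Complex.norm_real, mul_assoc (2 * Real.pi), mul_comm ‖w‖]
      gcongr
      exact norm_inner_le_norm z w)
    (Eventually.of_forall hsum)
  have hz : ∀ n : ℕ, ∫ z, (a * q z) ^ n / n.factorial * h z = 0 := fun n => by
    rw [← mul_zero (a ^ n / n.factorial), ← h0 w n, ← integral_const_mul]
    refine integral_congr_ae (Eventually.of_forall fun z => ?_)
    simp only [q]
    ring
  simp only [hz] at key
  rw [Real.fourier_eq']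
  rw [← key.unique hasSum_zero]
  refine integral_congr_ae (Eventually.of_forall fun z => ?_)
  simp only [a, q, smul_eq_mul]
  congr 2
  push_cast
  ring

/-! ### Position and derivative operators -/

theorem hasTemperateGrowth_conj : (fun z : ℂ => conj z).HasTemperateGrowth :=
  Complex.conjCLE.toContinuousLinearMap.hasTemperateGrowth

theorem phi_apply (f : SchwartzState) (z : ℂ) : phi f z = z • f z :=
  smulLeftCLM_apply_apply (by fun_prop) f z

theorem phiBar_apply (f : SchwartzState) (z : ℂ) : phiBar f z = conj z • f z :=
  smulLeftCLM_apply_apply hasTemperateGrowth_conj f z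

theorem dx_apply (f : SchwartzState) (z : ℂ) : dx f z = fderiv ℝ f z 1 :=
  SchwartzMap.lineDerivOp_apply_eq_fderiv 1 f z

theorem dy_apply (f : SchwartzState) (z : ℂ) : dy f z = fderiv ℝ f z Complex.I :=
  SchwartzMap.lineDerivOp_apply_eq_fderiv Complex.I f z

theorem fermionOp_apply (M : Matrix (Finset (Fin 2)) (Finset (Fin 2)) ℂ) (f : SchwartzState)
    (z : ℂ) : fermionOp M f z = Matrix.toEuclideanCLM (𝕜 := ℂ) M (f z) := rfl

theorem fderiv_phi (f : SchwartzState) (z v : ℂ) :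
    fderiv ℝ (phi f) z v = z • fderiv ℝ f z v + v • f z := by
  have h : ⇑(phi f) = fun z => z • f z := funext (phi_apply f)
  have h2 : HasFDerivAt (fun z : ℂ => z • f z) _ z :=
    (hasFDerivAt_id (𝕜 := ℝ) z).smul (f.hasFDerivAt z)
  rw [h, h2.fderiv]
  simp

theorem fderiv_phiBar (f : SchwartzState) (z v : ℂ) :
    fderiv ℝ (phiBar f) z v = conj z • fderiv ℝ f z v + conj v • f z := by
  have h : ⇑(phiBar f) = fun z => conj z • f z := funext (phiBar_apply f)
  have h2 : HasFDerivAt (fun z : ℂ => conj z • f z) _ z :=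
    (Complex.conjCLE.hasFDerivAt (x := z)).smul (f.hasFDerivAt z)
  rw [h, h2.fderiv]
  simp

theorem fderiv_fermionOp (M : Matrix (Finset (Fin 2)) (Finset (Fin 2)) ℂ) (f : SchwartzState)
    (z v : ℂ) :
    fderiv ℝ (fermionOp M f) z v = Matrix.toEuclideanCLM (𝕜 := ℂ) M (fderiv ℝ f z v) := by
  have h : ⇑(fermionOp M f) = ((Matrix.toEuclideanCLM (𝕜 := ℂ) M).restrictScalars ℝ) ∘ f := rfl
  rw [h, (((Matrix.toEuclideanCLM (𝕜 := ℂ) M).restrictScalars ℝ).hasFDerivAt.comp z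
    (f.hasFDerivAt z)).fderiv]
  rfl

theorem dx_phi : dx * phi = phi * dx + 1 := by
  ext1 f; ext1 z
  simp [dx_apply, phi_apply, fderiv_phi]

theorem dy_phi : dy * phi = phi * dy + Complex.I • 1 := by
  ext1 f; ext1 z
  simp [dy_apply, phi_apply, fderiv_phi]

theorem dx_phiBar : dx * phiBar = phiBar * dx + 1 := by
  ext1 f; ext1 z
  simp [dx_apply, phiBar_apply, fderiv_phiBar]

theorem dy_phiBar : dy * phiBar = phiBar * dy - Complex.I • 1 := by
  ext1 f; ext1 z
  simp [dy_apply, phiBar_apply, fderiv_phiBar, sub_eq_add_neg]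

theorem phi_phiBar : phi * phiBar = phiBar * phi := by
  ext1 f; ext1 z
  simp [phi_apply, phiBar_apply, smul_comm z]

theorem dx_dy : dx * dy = dy * dx := by
  ext1 f; ext1 z
  have hsym : IsSymmSndFDerivAt ℝ f z :=
    ((f.smooth 2).contDiffAt).isSymmSndFDerivAt (by simp)
  have hd : DifferentiableAt ℝ (fderiv ℝ f) z :=
    ((f.smooth 2).contDiffAt.fderiv_right (m := 1) (by norm_num)).differentiableAt one_ne_zero
  have key : ∀ v w : ℂ, fderiv ℝ (fun u => fderiv ℝ f u v) z w = fderiv ℝ (fderiv ℝ f) z w v :=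
    fun v w => by
      rw [fderiv_clm_apply hd (differentiableAt_const v)]
      simp
  have h1 : ⇑(dx f) = fun u => fderiv ℝ f u 1 := funext (dx_apply f)
  have h2 : ⇑(dy f) = fun u => fderiv ℝ f u Complex.I := funext (dy_apply f)
  rw [mul_apply_eq_comp, mul_apply_eq_comp, dx_apply, dy_apply, h1, h2, key, key]
  exact hsym _ _

/-- The Wirtinger derivative `∂ / ∂φ`. -/
def dz : Op := (1 / 2 : ℂ) • (dx - Complex.I • dy)

/-- The Wirtinger derivative `∂ / ∂(conj φ)`. -/
def dzBar : Op := (1 / 2 : ℂ) • (dx + Complex.I • dy)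

theorem mom_eq : mom = (-Complex.I) • dz := rfl

theorem momBar_eq : momBar = (-Complex.I) • dzBar := rfl

theorem dz_phi : dz * phi = phi * dz + 1 := by
  simp only [dz, smul_mul_assoc, sub_mul, dx_phi, dy_phi, mul_smul_comm, mul_sub]
  match_scalars <;> first | ring1 | linear_combination (-(1 / 2 : ℂ)) * Complex.I_sq

theorem dz_phiBar : dz * phiBar = phiBar * dz := by
  simp only [dz, smul_mul_assoc, sub_mul, dx_phiBar, dy_phiBar, mul_smul_comm, mul_sub]
  match_scalars <;> first | ring1 | linear_combination ((1 / 2 : ℂ)) * Complex.I_sq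

theorem dzBar_phi : dzBar * phi = phi * dzBar := by
  simp only [dzBar, smul_mul_assoc, add_mul, dx_phi, dy_phi, mul_smul_comm, mul_add]
  match_scalars <;> first | ring1 | linear_combination ((1 / 2 : ℂ)) * Complex.I_sq

theorem dzBar_phiBar : dzBar * phiBar = phiBar * dzBar + 1 := by
  simp only [dzBar, smul_mul_assoc, add_mul, dx_phiBar, dy_phiBar, mul_smul_comm, mul_add]
  match_scalars <;> first | ring1 | linear_combination (-(1 / 2 : ℂ)) * Complex.I_sq

theorem dz_dzBar : dz * dzBar = dzBar * dz := by
  simp only [dz, dzBar, smul_mul_assoc, mul_smul_comm, add_mul, mul_add, sub_mul, mul_sub, dx_dy]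
  module

/-! ### Ladder operators -/

/-- The operator lowering the quanta of angular momentum `-1`. -/
def annA : Op := phi + dzBar

/-- The operator raising the quanta of angular momentum `-1`, the adjoint of `annA`. -/
def creA : Op := phiBar - dz

/-- The operator lowering the quanta of angular momentum `1`. -/
def annB : Op := phiBar + dz

/-- The operator raising the quanta of angular momentum `1`, the adjoint of `annB`. -/
def creB : Op := phi - dzBar

theorem annA_creA : annA * creA = creA * annA + (2 : ℂ) • 1 := by
  simp only [annA, creA, add_mul, mul_add, sub_mul, mul_sub, phi_phiBar, dz_phi, dzBar_phiBar,
    dz_dzBar]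
  module

theorem annB_creB : annB * creB = creB * annB + (2 : ℂ) • 1 := by
  simp only [annB, creB, add_mul, mul_add, sub_mul, mul_sub, phi_phiBar, dz_phi, dzBar_phiBar,
    dz_dzBar]
  module

theorem annA_creB : annA * creB = creB * annA := by
  simp only [annA, creB, add_mul, mul_add, sub_mul, mul_sub, dzBar_phi]
  abel

theorem annB_creA : annB * creA = creA * annB := by
  simp only [annB, creA, add_mul, mul_add, sub_mul, mul_sub, dz_phiBar]
  abel

theorem creA_creB : creA * creB = creB * creA := by
  simp only [creA, creB, mul_sub, sub_mul, phi_phiBar, dz_phi, dzBar_phiBar, dz_dzBar]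
  abel

theorem phi_eq : phi = (1 / 2 : ℂ) • (annA + creB) := by
  simp only [annA, creB]
  module

theorem phiBar_eq : phiBar = (1 / 2 : ℂ) • (annB + creA) := by
  simp only [annB, creA]
  module

/-! ### The fermionic matrices -/

theorem psiMat_apply (α : Fin 2) (s t : Finset (Fin 2)) :
    psiMat α s t = if α ∈ s ∧ t = s.erase α then (-1) ^ (t.filter fun γ => γ < α).card else 0 := by
  rw [psiMat, Matrix.of_apply]
  refine if_congr ⟨?_, ?_⟩ rfl rfl
  · rintro ⟨h, rfl⟩
    exact ⟨Finset.mem_insert_self α t, (Finset.erase_insert h).symm⟩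
  · rintro ⟨h, rfl⟩
    exact ⟨Finset.notMem_erase α s, (Finset.insert_erase h).symm⟩

theorem neg_one_pow_mul_star (k : ℕ) : (-1 : ℂ) ^ k * star ((-1 : ℂ) ^ k) = 1 := by
  rw [star_pow, ← mul_pow]
  simp

theorem psiMat_mul_psiBarMat (α : Fin 2) :
    psiMat α * psiBarMat α = Matrix.diagonal fun s => if α ∈ s then 1 else 0 := by
  ext s t
  rw [Matrix.mul_apply, Matrix.diagonal_apply]
  simp only [psiBarMat, Matrix.conjTranspose_apply, psiMat_apply]
  by_cases hs : α ∈ s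
  · rw [Finset.sum_eq_single (s.erase α) (fun u _ hu => by simp [hu]) (by simp)]
    by_cases hst : s = t
    · subst hst
      simp only [hs, and_self, if_true, neg_one_pow_mul_star]
    · have : ¬ (α ∈ t ∧ s.erase α = t.erase α) := fun ⟨ht, h⟩ => hst (by
        rw [← Finset.insert_erase hs, h, Finset.insert_erase ht])
      simp [this, hst]
  · simp [hs]

theorem psiBarMat_mul_psiMat (α : Fin 2) :
    psiBarMat α * psiMat α = Matrix.diagonal fun s => if α ∈ s then 0 else 1 := by
  ext s t
  rw [Matrix.mul_apply, Matrix.diagonal_apply]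
  simp only [psiBarMat, Matrix.conjTranspose_apply, psiMat, Matrix.of_apply]
  by_cases hs : α ∈ s
  · simp [hs]
  · rw [Finset.sum_eq_single (insert α s) (fun u _ hu => by simp [hu]) (by simp)]
    by_cases hst : s = t
    · subst hst
      simp only [hs, not_false_eq_true, and_self, if_true, if_false]
      rw [mul_comm, neg_one_pow_mul_star]
    · have : ¬ (α ∉ t ∧ insert α s = insert α t) := fun ⟨ht, h⟩ => hst (by
        rw [← Finset.erase_insert hs, h, Finset.erase_insert ht])
      simp [this, hst]

/-- The matrix of the fermion number in the monomial basis. -/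
def numberMat : Matrix (Finset (Fin 2)) (Finset (Fin 2)) ℂ := Matrix.diagonal fun s => s.card

theorem sum_psiMat_mul_psiBarMat : ∑ α, psiMat α * psiBarMat α = numberMat := by
  simp only [psiMat_mul_psiBarMat, numberMat]
  ext s t
  rw [Matrix.sum_apply]
  obtain rfl | h := eq_or_ne s t
  · simp only [Matrix.diagonal_apply_eq]
    rw [Finset.sum_boole, Finset.filter_univ_mem]
  · simp [h]

theorem fermionOp_mul (M N : Matrix (Finset (Fin 2)) (Finset (Fin 2)) ℂ) :
    fermionOp M * fermionOp N = fermionOp (M * N) := by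
  ext1 f; ext1 z
  rw [mul_apply_eq_comp, fermionOp_apply, fermionOp_apply, fermionOp_apply, map_mul]
  rfl

theorem fermionOp_one : fermionOp 1 = 1 := by
  ext1 f; ext1 z
  rw [fermionOp_apply, map_one]
  rfl

theorem fermionOp_add (M N : Matrix (Finset (Fin 2)) (Finset (Fin 2)) ℂ) :
    fermionOp (M + N) = fermionOp M + fermionOp N := by
  ext1 f; ext1 z
  rw [fermionOp_apply, map_add]
  rfl

theorem fermionCharge_eq : fermionCharge = fermionOp numberMat := by
  rw [fermionCharge, ← sum_psiMat_mul_psiBarMat, Fin.sum_univ_two, Fin.sum_univ_two, fermionOp_add]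
  simp only [psi, psiBar, fermionOp_mul]

/-- The canonical anticommutation relation of a fermion with its adjoint. -/
theorem psiBar_mul_psi (α : Fin 2) : psiBar α * psi α = 1 - psi α * psiBar α := by
  rw [eq_sub_iff_add_eq, psi, psiBar, fermionOp_mul, fermionOp_mul, ← fermionOp_add,
    ← fermionOp_one, psiMat_mul_psiBarMat, psiBarMat_mul_psiMat, Matrix.diagonal_add,
    ← Matrix.diagonal_one]
  congr 2
  ext s
  split_ifs <;> simp

theorem ham_eq : ham = (1 / 2 : ℂ) • (creA * annA + creB * annB) + fermionCharge := by
  simp only [ham, fermionCharge, mom_eq, momBar_eq, psiBar_mul_psi, Fin.sum_univ_two, creA, annA,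
    creB, annB, mul_add, sub_mul, smul_mul_assoc, mul_smul_comm, phi_phiBar,
    dz_phi, dzBar_phiBar, dz_dzBar]
  match_scalars <;> first | ring1 | linear_combination Complex.I_sq

theorem angMom_eq : angMom = (1 / 2 : ℂ) • (creB * annB - creA * annA) := by
  simp only [angMom, mom_eq, momBar_eq, creA, annA, creB, annB, mul_add, sub_mul, mul_smul_comm, phi_phiBar, dz_phi, dzBar_phiBar, dz_dzBar]
  match_scalars <;>
    first | ring1 | linear_combination Complex.I_sq | linear_combination -Complex.I_sq

/-! ### Adjoints on Schwartz states -/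

theorem inner_toHilb (f g : SchwartzState) :
    ⟪toHilb f, toHilb g⟫ = ∫ z, ⟪f z, g z⟫ :=
  SchwartzMap.inner_toL2_toL2_eq f g volume

/-- `S` and `T` are formal adjoints of each other on Schwartz states. -/
def IsAdj (S T : Op) : Prop := ∀ f g, ⟪toHilb (S f), toHilb g⟫ = ⟪toHilb f, toHilb (T g)⟫

theorem IsAdj.symm {S T : Op} (h : IsAdj S T) : IsAdj T S := fun f g => by
  rw [← inner_conj_symm, ← h, inner_conj_symm]

theorem IsAdj.add {S T S' T' : Op} (h : IsAdj S T) (h' : IsAdj S' T') :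
    IsAdj (S + S') (T + T') := fun f g => by
  simp only [add_apply, map_add, inner_add_left, inner_add_right, h f g, h' f g]

theorem IsAdj.smul {S T : Op} (h : IsAdj S T) (a : ℂ) : IsAdj (a • S) (conj a • T) := fun f g => by
  simp only [smul_apply, map_smul, inner_smul_left, inner_smul_right, h f g]

theorem IsAdj.mul {S T S' T' : Op} (h : IsAdj S T) (h' : IsAdj S' T') :
    IsAdj (S * S') (T' * T) := fun f g => by
  simp only [mul_apply_eq_comp, h _ g, h' f _]

theorem isAdj_of_pointwise {S T : Op} (h : ∀ f g z, ⟪S f z, g z⟫ = ⟪f z, T g z⟫) : IsAdj S T :=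
  fun f g => by simp only [inner_toHilb, h]

theorem isAdj_phi : IsAdj phi phiBar := isAdj_of_pointwise fun f g z => by
  rw [phi_apply, phiBar_apply, inner_smul_left, inner_smul_right]

theorem isAdj_fermionOp (M : Matrix (Finset (Fin 2)) (Finset (Fin 2)) ℂ) :
    IsAdj (fermionOp M) (fermionOp Mᴴ) := isAdj_of_pointwise fun f g z => by
  rw [fermionOp_apply, fermionOp_apply, ← Matrix.star_eq_conjTranspose, map_star,
    ContinuousLinearMap.star_eq_adjoint, ContinuousLinearMap.adjoint_inner_right]

/-- Integration by parts. -/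
theorem isAdj_lineDeriv (v : ℂ) :
    IsAdj (LineDeriv.lineDerivOpCLM ℂ SchwartzState v)
      ((-1 : ℂ) • LineDeriv.lineDerivOpCLM ℂ SchwartzState v) := fun f g => by
  have h := SchwartzMap.integral_bilinear_lineDerivOp_right_eq_neg_left (μ := volume) f g
    (isBoundedBilinearMap_inner (𝕜 := ℂ) (E := Fock)).toContinuousLinearMap v
  rw [smul_apply, map_smul, inner_smul_right, inner_toHilb, inner_toHilb, neg_one_mul]
  exact neg_eq_iff_eq_neg.1 h.symm

theorem isAdj_dz : IsAdj dz ((-1 : ℂ) • dzBar) := by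
  have h1 := isAdj_lineDeriv 1
  have h2 := isAdj_lineDeriv Complex.I
  have h := (h1.add (h2.smul (-Complex.I))).smul (1 / 2)
  convert h using 1
  · simp only [dz, dx, dy]
    module
  · simp only [dzBar, dx, dy, map_neg, Complex.conj_I, map_div₀, map_one, map_ofNat]
    module

theorem isAdj_creA : IsAdj creA annA := by
  have h := isAdj_phi.symm.add (isAdj_dz.smul (-1))
  convert h using 1
  · simp only [creA]
    module
  · simp only [annA, map_neg, map_one]
    module

theorem isAdj_annB : IsAdj annB creB := by
  have h := isAdj_phi.symm.add isAdj_dz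
  have e : creB = phi + (-1 : ℂ) • dzBar := by
    simp only [creB]
    module
  rwa [e]

theorem isAdj_creA_annA : IsAdj (creA * annA) (creA * annA) := isAdj_creA.mul isAdj_creA.symm

theorem isAdj_creB_annB : IsAdj (creB * annB) (creB * annB) := isAdj_annB.symm.mul isAdj_annB

theorem isAdj_diagonal (c : Finset (Fin 2) → ℝ) :
    IsAdj (fermionOp (Matrix.diagonal fun s => (c s : ℂ)))
      (fermionOp (Matrix.diagonal fun s => (c s : ℂ))) := by
  have h := isAdj_fermionOp (Matrix.diagonal fun s => (c s : ℂ))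
  rw [Matrix.diagonal_conjTranspose] at h
  have e : star (fun s => (c s : ℂ)) = fun s => (c s : ℂ) := by
    ext s
    simp
  rwa [e] at h

/-- The Hamiltonians are symmetric on Schwartz states. -/
theorem isAdj_hamLam (lam : ℝ) : IsAdj (hamLam lam) (hamLam lam) := by
  have hF : IsAdj fermionCharge fermionCharge := by
    rw [fermionCharge_eq, numberMat]
    exact_mod_cast isAdj_diagonal fun s => (s.card : ℝ)
  have h := ((isAdj_creA_annA.smul ((1 - lam) / 2 : ℝ)).add
    (isAdj_creB_annB.smul ((1 + lam) / 2 : ℝ))).add (hF.smul ((1 + lam : ℝ) : ℂ))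
  simp only [Complex.conj_ofReal] at h
  have e : hamLam lam = (((1 - lam) / 2 : ℝ) : ℂ) • (creA * annA)
      + (((1 + lam) / 2 : ℝ) : ℂ) • (creB * annB) + ((1 + lam : ℝ) : ℂ) • fermionCharge := by
    rw [hamLam, chargeK, ham_eq, angMom_eq]
    push_cast
    module
  rw [e]
  exact h

/-! ### The states generated by the ladder operators -/

/-- The Gaussian ground state of the bosons times the fermion monomial of `s`. -/
def vac (s : Finset (Fin 2)) : SchwartzState :=
  SchwartzMap.postcompCLM
    (ContinuousLinearMap.toSpanSingleton ℝ (EuclideanSpace.single s (1 : ℂ) : Fock))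
    (gaussian 1 one_pos)

theorem vac_apply (s : Finset (Fin 2)) (z : ℂ) :
    vac s z = gaussian 1 one_pos z • (EuclideanSpace.single s (1 : ℂ) : Fock) := rfl

theorem fderiv_vac (s : Finset (Fin 2)) (z v : ℂ) :
    fderiv ℝ (vac s) z v = ((-(2 * inner ℝ z v) : ℝ) : ℂ) • vac s z := by
  have h1 : HasFDerivAt (fun z : ℂ => Real.exp (-(1 * ‖z‖ ^ 2))) _ z :=
    (((hasStrictFDerivAt_norm_sq z).hasFDerivAt.const_mul (1 : ℝ)).neg).exp
  have h2 : HasFDerivAt (fun z => vac s z) _ z :=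
    (ContinuousLinearMap.toSpanSingleton ℝ
      (EuclideanSpace.single s (1 : ℂ) : Fock)).hasFDerivAt.comp z h1
  rw [h2.fderiv, vac_apply, gaussian_apply, Complex.coe_smul, smul_smul]
  simp
  module

theorem dzBar_vac (s : Finset (Fin 2)) : dzBar (vac s) = -phi (vac s) := by
  ext1 z
  have h : dzBar (vac s) z = (1 / 2 : ℂ) • (dx (vac s) z + Complex.I • dy (vac s) z) := rfl
  rw [h, neg_apply, phi_apply, dx_apply, dy_apply, fderiv_vac, fderiv_vac, smul_smul, ← add_smul,
    smul_smul, ← neg_smul]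
  congr 1
  apply Complex.ext <;> simp [Complex.inner]

theorem dz_vac (s : Finset (Fin 2)) : dz (vac s) = -phiBar (vac s) := by
  ext1 z
  have h : dz (vac s) z = (1 / 2 : ℂ) • (dx (vac s) z - Complex.I • dy (vac s) z) := rfl
  rw [h, neg_apply, phiBar_apply, dx_apply, dy_apply, fderiv_vac, fderiv_vac, smul_smul,
    ← sub_smul, smul_smul, ← neg_smul]
  congr 1
  apply Complex.ext <;> simp [Complex.inner]

theorem annA_vac (s : Finset (Fin 2)) : annA (vac s) = 0 := by
  rw [annA, add_apply, dzBar_vac, add_neg_cancel]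

theorem annB_vac (s : Finset (Fin 2)) : annB (vac s) = 0 := by
  rw [annB, add_apply, dz_vac, add_neg_cancel]

theorem commute_fermionOp_creA (M : Matrix (Finset (Fin 2)) (Finset (Fin 2)) ℂ) :
    Commute (fermionOp M) creA := by
  ext1 f; ext1 z
  have h : ∀ g : SchwartzState, ∀ z, creA g z
      = conj z • g z - (1 / 2 : ℂ) • (fderiv ℝ g z 1 - Complex.I • fderiv ℝ g z Complex.I) :=
    fun g z => by
      rw [← phiBar_apply, ← dx_apply, ← dy_apply]
      rfl
  rw [mul_apply_eq_comp, mul_apply_eq_comp, fermionOp_apply, h, h, fderiv_fermionOp,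
    fderiv_fermionOp, fermionOp_apply]
  simp only [map_sub, map_smul]

theorem commute_fermionOp_creB (M : Matrix (Finset (Fin 2)) (Finset (Fin 2)) ℂ) :
    Commute (fermionOp M) creB := by
  ext1 f; ext1 z
  have h : ∀ g : SchwartzState, ∀ z, creB g z
      = z • g z - (1 / 2 : ℂ) • (fderiv ℝ g z 1 + Complex.I • fderiv ℝ g z Complex.I) :=
    fun g z => by
      rw [← phi_apply, ← dx_apply, ← dy_apply]
      rfl
  rw [mul_apply_eq_comp, mul_apply_eq_comp, fermionOp_apply, h, h, fderiv_fermionOp,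
    fderiv_fermionOp, fermionOp_apply]
  simp only [map_sub, map_add, map_smul]

/-- Commuting a lowering operator through a power of its raising operator. -/
theorem ann_mul_cre_pow {a c : Op} (h : a * c = c * a + (2 : ℂ) • 1) (n : ℕ) :
    a * c ^ (n + 1) = c ^ (n + 1) * a + (2 * (n + 1) : ℂ) • c ^ n := by
  induction n with
  | zero => simpa using h
  | succ n ih =>
    rw [pow_succ c (n + 1), ← mul_assoc, ih, add_mul, mul_assoc, h, mul_add, ← mul_assoc,
      smul_mul_assoc, mul_smul_comm, mul_one, ← pow_succ c n]
    push_cast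
    module

/-- The unnormalized state with `j` quanta of angular momentum `-1`, `k` quanta of angular momentum
`1` and fermion content `s`. -/
def state (j k : ℕ) (s : Finset (Fin 2)) : SchwartzState := (creA ^ j) ((creB ^ k) (vac s))

theorem creA_state (j k : ℕ) (s : Finset (Fin 2)) : creA (state j k s) = state (j + 1) k s := by
  rw [state, state, pow_succ', mul_apply_eq_comp]

theorem creB_state (j k : ℕ) (s : Finset (Fin 2)) : creB (state j k s) = state j (k + 1) s := by
  have h : creB * creA ^ j = creA ^ j * creB := (Commute.pow_left creA_creB j).symm
  rw [state, state, pow_succ' creB, mul_apply_eq_comp, ← mul_apply_eq_comp, h, mul_apply_eq_comp]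

theorem annA_state_zero (k : ℕ) (s : Finset (Fin 2)) : annA (state 0 k s) = 0 := by
  have h : annA * creB ^ k = creB ^ k * annA := Commute.pow_right annA_creB k
  rw [state, pow_zero, one_apply_eq_self, ← mul_apply_eq_comp, h, mul_apply_eq_comp, annA_vac,
    map_zero]

theorem annA_state_succ (j k : ℕ) (s : Finset (Fin 2)) :
    annA (state (j + 1) k s) = (2 * (j + 1) : ℂ) • state j k s := by
  have h := annA_state_zero k s
  rw [state, pow_zero, one_apply_eq_self] at h
  rw [state, ← mul_apply_eq_comp, ann_mul_cre_pow annA_creA, add_apply, mul_apply_eq_comp, h,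
    map_zero, zero_add, smul_apply, state]

theorem annB_state_zero (j : ℕ) (s : Finset (Fin 2)) : annB (state j 0 s) = 0 := by
  have h : annB * creA ^ j = creA ^ j * annB := Commute.pow_right annB_creA j
  rw [state, pow_zero, one_apply_eq_self, ← mul_apply_eq_comp, h, mul_apply_eq_comp, annB_vac,
    map_zero]

theorem annB_state_succ (j k : ℕ) (s : Finset (Fin 2)) :
    annB (state j (k + 1) s) = (2 * (k + 1) : ℂ) • state j k s := by
  have h : annB * creA ^ j = creA ^ j * annB := Commute.pow_right annB_creA j
  rw [state, ← mul_apply_eq_comp, h, mul_apply_eq_comp, ← mul_apply_eq_comp annB (creB ^ _),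
    ann_mul_cre_pow annB_creB, add_apply, mul_apply_eq_comp, annB_vac, map_zero, zero_add,
    smul_apply, map_smul, state]

theorem creA_annA_state (j k : ℕ) (s : Finset (Fin 2)) :
    (creA * annA) (state j k s) = ((2 * j : ℝ) : ℂ) • state j k s := by
  rw [mul_apply_eq_comp]
  cases j with
  | zero => simp [annA_state_zero]
  | succ j =>
    rw [annA_state_succ, map_smul, creA_state]
    push_cast
    rfl

theorem creB_annB_state (j k : ℕ) (s : Finset (Fin 2)) :
    (creB * annB) (state j k s) = ((2 * k : ℝ) : ℂ) • state j k s := by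
  rw [mul_apply_eq_comp]
  cases k with
  | zero => simp [annB_state_zero]
  | succ k =>
    rw [annB_state_succ, map_smul, creB_state]
    push_cast
    rfl

theorem fermionOp_diagonal_state (c : Finset (Fin 2) → ℂ) (j k : ℕ) (s : Finset (Fin 2)) :
    fermionOp (Matrix.diagonal c) (state j k s) = c s • state j k s := by
  have hA := (commute_fermionOp_creA (Matrix.diagonal c)).pow_right j
  have hB := (commute_fermionOp_creB (Matrix.diagonal c)).pow_right k
  have hv : fermionOp (Matrix.diagonal c) (vac s) = c s • vac s := by
    ext1 z
    rw [fermionOp_apply, smul_apply, vac_apply, ← Complex.coe_smul, map_smul, smul_comm]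
    congr 1
    ext t
    simp [Matrix.ofLp_toEuclideanCLM, Matrix.mulVec_diagonal, Pi.single_apply]
    split_ifs with h
    · rw [h]
    · rfl
  rw [state, ← mul_apply_eq_comp, hA.eq, mul_apply_eq_comp, ← mul_apply_eq_comp _ (creB ^ k), hB.eq,
    mul_apply_eq_comp, hv, map_smul, map_smul]

theorem fermionCharge_state (j k : ℕ) (s : Finset (Fin 2)) :
    fermionCharge (state j k s) = (s.card : ℂ) • state j k s := by
  rw [fermionCharge_eq, numberMat, fermionOp_diagonal_state]

theorem angMom_state (j k : ℕ) (s : Finset (Fin 2)) :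
    angMom (state j k s) = ((k : ℂ) - j) • state j k s := by
  rw [angMom_eq, smul_apply, sub_apply, creA_annA_state, creB_annB_state]
  push_cast
  module

theorem hamLam_state (lam : ℝ) (j k : ℕ) (s : Finset (Fin 2)) :
    hamLam lam (state j k s)
      = ((j * (1 - lam) + (k + s.card) * (1 + lam) : ℝ) : ℂ) • state j k s := by
  rw [hamLam, chargeK, ham_eq]
  simp only [add_apply, smul_apply, creA_annA_state, creB_annB_state, fermionCharge_state,
    angMom_state]
  push_cast
  module

theorem vac_ne_zero (s : Finset (Fin 2)) : vac s ≠ 0 := by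
  intro h
  have h1 : vac s 0 = 0 := by rw [h]; rfl
  rw [vac_apply, gaussian_apply, smul_eq_zero] at h1
  rcases h1 with h1 | h1
  · exact (Real.exp_pos _).ne' h1
  · simp at h1

theorem state_ne_zero (j k : ℕ) (s : Finset (Fin 2)) : state j k s ≠ 0 := by
  induction j with
  | zero =>
    induction k with
    | zero => exact vac_ne_zero s
    | succ k ih =>
      intro h
      have h1 := annB_state_succ 0 k s
      rw [h, map_zero, eq_comm, smul_eq_zero] at h1
      exact h1.elim (by norm_cast) ih
  | succ j ih =>
    intro h
    have h1 := annA_state_succ j k s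
    rw [h, map_zero, eq_comm, smul_eq_zero] at h1
    exact h1.elim (by norm_cast) ih

/-! ### Orthonormality -/

/-- Eigenvectors of a symmetric operator with distinct real eigenvalues are orthogonal. -/
theorem inner_eq_zero_of_isAdj {T : Op} (hT : IsAdj T T) {f g : SchwartzState} {a b : ℝ}
    (hf : T f = (a : ℂ) • f) (hg : T g = (b : ℂ) • g) (hab : a ≠ b) :
    ⟪toHilb f, toHilb g⟫ = 0 := by
  have h := hT f g
  rw [hf, hg, map_smul, map_smul, inner_smul_left, inner_smul_right, Complex.conj_ofReal,
    ← sub_eq_zero, ← sub_mul, mul_eq_zero, sub_eq_zero, Complex.ofReal_inj] at h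
  exact h.resolve_left hab

/-- The normalized eigenstates. -/
def unitState (p : ℕ × ℕ × Finset (Fin 2)) : SchwartzState :=
  ((‖toHilb (state p.1 p.2.1 p.2.2)‖⁻¹ : ℝ) : ℂ) • state p.1 p.2.1 p.2.2

theorem orthonormal_unitState : Orthonormal ℂ fun p => toHilb (unitState p) := by
  constructor
  · rintro ⟨j, k, s⟩
    have h : ‖toHilb (state j k s)‖ ≠ 0 :=
      norm_ne_zero_iff.2 ((map_ne_zero_iff toHilb toHilb_injective).2 (state_ne_zero j k s))
    change ‖toHilb (unitState (j, k, s))‖ = 1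
    rw [unitState, map_smul, norm_smul, Complex.norm_real, norm_inv, norm_norm,
      inv_mul_cancel₀ h]
  · rintro ⟨j, k, s⟩ ⟨j', k', s'⟩ hne
    simp only [unitState, map_smul, inner_smul_left, inner_smul_right]
    suffices h : ⟪toHilb (state j k s), toHilb (state j' k' s')⟫ = 0 by
      rw [h, mul_zero, mul_zero]
    by_cases hj : j = j'
    · by_cases hk : k = k'
      · have hs : s ≠ s' := fun hs => hne (by rw [hj, hk, hs])
        -- the projection onto the monomial of `s` separates the two states
        let c : Finset (Fin 2) → ℝ := fun t => if t = s then 1 else 0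
        refine inner_eq_zero_of_isAdj (isAdj_diagonal c) (fermionOp_diagonal_state _ j k s)
          (fermionOp_diagonal_state _ j' k' s') ?_
        simp [c, hs.symm]
      · refine inner_eq_zero_of_isAdj isAdj_creB_annB (creB_annB_state j k s)
          (creB_annB_state j' k' s') ?_
        simpa using hk
    · refine inner_eq_zero_of_isAdj isAdj_creA_annA (creA_annA_state j k s)
        (creA_annA_state j' k' s') ?_
      simpa using hj

/-! ### Completeness -/

/-- The span of the eigenstates, which are the polynomials in `φ` and `conj φ` times the Gaussian. -/
def stateSpan : Submodule ℂ SchwartzState := Submodule.span ℂ (Set.range unitState)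

theorem state_mem_stateSpan (j k : ℕ) (s : Finset (Fin 2)) : state j k s ∈ stateSpan := by
  have h : ((‖toHilb (state j k s)‖ : ℝ) : ℂ) • unitState (j, k, s) = state j k s := by
    have h1 : ‖toHilb (state j k s)‖ ≠ 0 :=
      norm_ne_zero_iff.2 ((map_ne_zero_iff toHilb toHilb_injective).2 (state_ne_zero j k s))
    rw [unitState, smul_smul, ← Complex.ofReal_mul, mul_inv_cancel₀ h1, Complex.ofReal_one,
      one_smul]
  rw [← h]
  exact stateSpan.smul_mem _ (Submodule.subset_span ⟨_, rfl⟩)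

theorem mem_stateSpan_of_forall_state {T : Op} (hT : ∀ j k s, T (state j k s) ∈ stateSpan)
    {f : SchwartzState} (hf : f ∈ stateSpan) : T f ∈ stateSpan := by
  induction hf using Submodule.span_induction with
  | mem x hx =>
    obtain ⟨p, rfl⟩ := hx
    rw [unitState, map_smul]
    exact stateSpan.smul_mem _ (hT _ _ _)
  | zero => rw [map_zero]; exact stateSpan.zero_mem
  | add x y _ _ hx hy => rw [map_add]; exact stateSpan.add_mem hx hy
  | smul a x _ hx => rw [map_smul]; exact stateSpan.smul_mem _ hx

theorem phi_mem_stateSpan {f : SchwartzState} (hf : f ∈ stateSpan) : phi f ∈ stateSpan := by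
  refine mem_stateSpan_of_forall_state (fun j k s => ?_) hf
  rw [phi_eq, smul_apply, add_apply, creB_state]
  refine stateSpan.smul_mem _ (stateSpan.add_mem ?_ (state_mem_stateSpan _ _ _))
  cases j with
  | zero => rw [annA_state_zero]; exact stateSpan.zero_mem
  | succ j => rw [annA_state_succ]; exact stateSpan.smul_mem _ (state_mem_stateSpan _ _ _)

theorem phiBar_mem_stateSpan {f : SchwartzState} (hf : f ∈ stateSpan) : phiBar f ∈ stateSpan := by
  refine mem_stateSpan_of_forall_state (fun j k s => ?_) hf
  rw [phiBar_eq, smul_apply, add_apply, creA_state]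
  refine stateSpan.smul_mem _ (stateSpan.add_mem ?_ (state_mem_stateSpan _ _ _))
  cases k with
  | zero => rw [annB_state_zero]; exact stateSpan.zero_mem
  | succ k => rw [annB_state_succ]; exact stateSpan.smul_mem _ (state_mem_stateSpan _ _ _)

/-- Multiplication by the real linear form `⟪·, w⟫` preserves the span of the eigenstates. -/
theorem exists_mem_stateSpan (w : ℂ) (n : ℕ) (s : Finset (Fin 2)) :
    ∃ f ∈ stateSpan, ∀ z, f z = ((inner ℝ z w : ℝ) : ℂ) ^ n • vac s z := by
  induction n with
  | zero => exact ⟨vac s, state_mem_stateSpan 0 0 s, fun z => by simp⟩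
  | succ n ih =>
    obtain ⟨f, hf, h⟩ := ih
    refine ⟨(conj w / 2) • phi f + (w / 2) • phiBar f,
      stateSpan.add_mem (stateSpan.smul_mem _ (phi_mem_stateSpan hf))
        (stateSpan.smul_mem _ (phiBar_mem_stateSpan hf)), fun z => ?_⟩
    rw [add_apply, smul_apply, smul_apply, phi_apply, phiBar_apply, h, pow_succ']
    simp only [smul_smul, ← add_smul, ← mul_assoc, ← add_mul]
    congr 2
    apply Complex.ext <;> simp [Complex.inner] <;> ring

theorem orthogonal_span_unitState :
    (Submodule.span ℂ (Set.range fun p => toHilb (unitState p)))ᗮ = ⊥ := by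
  rw [Submodule.eq_bot_iff]
  intro F hF
  have hspan : ∀ f ∈ stateSpan, ⟪toHilb f, F⟫ = 0 := fun f hf => by
    refine Submodule.inner_right_of_mem_orthogonal (K := Submodule.span ℂ
      (Set.range fun p => toHilb (unitState p))) ?_ hF
    have := Submodule.mem_map_of_mem (f := toHilb) hf
    rwa [stateSpan, Submodule.map_span, ← Set.range_comp] at this
  have hcoord : ∀ s, (fun z => (gaussian 1 one_pos z : ℂ) * F z s) =ᵐ[volume] 0 := fun s => by
    have hs : MemLp (fun z => F z s) 2 volume :=
      (ContinuousLinearMap.comp_memLp' (EuclideanSpace.proj (𝕜 := ℂ) s) (Lp.memLp F))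
    refine ae_eq_zero_of_moments_eq_zero ?_ (integrable_exp_mul_gaussian_mul hs) fun w n => ?_
    · exact (Complex.continuous_ofReal.comp
        (gaussian 1 one_pos).continuous).aestronglyMeasurable.mul hs.1
    · obtain ⟨f, hf, h⟩ := exists_mem_stateSpan w n s
      rw [← hspan f hf, L2.inner_def]
      refine integral_congr_ae ?_
      filter_upwards [SchwartzMap.coeFn_toLp f 2 volume] with z hz
      have hz' : toHilb f z = f z := hz
      rw [hz', h, vac_apply, ← Complex.coe_smul, inner_smul_left, inner_smul_left,
        EuclideanSpace.inner_single_left]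
      simp
  have hF0 : F =ᵐ[volume] 0 := by
    filter_upwards [ae_all_iff.2 hcoord] with z hz
    ext s
    have h := hz s
    simp only [Pi.zero_apply, mul_eq_zero, Complex.ofReal_eq_zero] at h
    exact h.resolve_left (Real.exp_pos _).ne'
  exact (Lp.eq_zero_iff_ae_eq_zero).2 hF0

/-- The Hilbert basis of eigenstates, labelled by the two numbers of bosonic quanta and the fermion
content. -/
def stateBasis : HilbertBasis (ℕ × ℕ × Finset (Fin 2)) ℂ Hilb :=
  HilbertBasis.mkOfOrthogonalEqBot orthonormal_unitState orthogonal_span_unitState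

theorem stateBasis_apply (p : ℕ × ℕ × Finset (Fin 2)) :
    stateBasis p = toHilb (unitState p) := by
  rw [stateBasis, HilbertBasis.coe_mkOfOrthogonalEqBot]

/-! ### Spectrum and index of the Hamiltonians -/

/-- The energy of the state with `p.1` and `p.2.1` quanta of angular momentum `-1` and `1` and
fermion content `p.2.2`. -/
def energy (lam : ℝ) (p : ℕ × ℕ × Finset (Fin 2)) : ℝ :=
  p.1 * (1 - lam) + (p.2.1 + p.2.2.card) * (1 + lam)

theorem hamLam_unitState (lam : ℝ) (p : ℕ × ℕ × Finset (Fin 2)) :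
    hamLam lam (unitState p) = (energy lam p : ℂ) • unitState p := by
  rw [unitState, map_smul, hamLam_state, smul_comm, energy]

theorem mem_graph_toPMap {T : Op} {p : Hilb × Hilb} :
    p ∈ (toPMap T).graph ↔ ∃ f, toHilb f = p.1 ∧ toHilb (T f) = p.2 := by
  have h : ∀ (f : SchwartzState) (hf : toHilb f ∈ (toPMap T).domain),
      toPMap T ⟨toHilb f, hf⟩ = toHilb (T f) := fun f hf => by
    have : (LinearEquiv.ofInjective toHilb toHilb_injective).symm ⟨toHilb f, hf⟩ = f := by
      rw [LinearEquiv.symm_apply_eq]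
      rfl
    change toHilb (T ((LinearEquiv.ofInjective toHilb toHilb_injective).symm ⟨toHilb f, hf⟩)) = _
    rw [this]
  rw [LinearPMap.mem_graph_iff]
  constructor
  · rintro ⟨⟨_, f, rfl⟩, h1, h2⟩
    exact ⟨f, h1, (h f ⟨f, rfl⟩).symm.trans h2⟩
  · rintro ⟨f, h1, h2⟩
    exact ⟨⟨toHilb f, f, rfl⟩, h1, (h f ⟨f, rfl⟩).trans h2⟩

theorem graph_hamiltonian (lam : ℝ) :
    (hamiltonian lam).graph = diagGraph stateBasis (energy lam) := by
  refine graph_closure_eq_diagGraph (fun p => ?_) fun q hq => mem_diagGraph.2 fun p => ?_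
  · refine mem_graph_toPMap.2 ⟨unitState p, (stateBasis_apply p).symm, ?_⟩
    rw [hamLam_unitState, map_smul, stateBasis_apply]
  · obtain ⟨f, h1, h2⟩ := mem_graph_toPMap.1 hq
    rw [← h1, ← h2, stateBasis_apply, ← isAdj_hamLam, hamLam_unitState, map_smul, inner_smul_left,
      Complex.conj_ofReal]

theorem isSelfAdjoint_hamiltonian (lam : ℝ) : IsSelfAdjoint (hamiltonian lam) :=
  isSelfAdjoint_of_graph_eq_diagGraph (graph_hamiltonian lam)

theorem parity_toHilb (f : SchwartzState) :
    parity (toHilb f) = toHilb (fermionOp parityMat f) := by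
  apply Lp.ext
  have h1 := ContinuousLinearMap.coeFn_compLpL (𝕜' := ℂ) (p := 2) (μ := (volume : Measure ℂ))
    (Matrix.toEuclideanCLM (𝕜 := ℂ) parityMat) (toHilb f)
  have h2 : toHilb f =ᵐ[volume] f := SchwartzMap.coeFn_toLp f 2 volume
  have h3 : toHilb (fermionOp parityMat f) =ᵐ[volume] fermionOp parityMat f :=
    SchwartzMap.coeFn_toLp _ 2 volume
  filter_upwards [h1, h2, h3] with z h1 h2 h3
  rw [h3, fermionOp_apply, ← h2]
  exact h1

theorem parity_stateBasis (p : ℕ × ℕ × Finset (Fin 2)) :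
    parity (stateBasis p) = ((-1 : ℂ) ^ p.2.2.card) • stateBasis p := by
  rw [stateBasis_apply, parity_toHilb, unitState, map_smul, parityMat, fermionOp_diagonal_state,
    map_smul, map_smul, map_smul, smul_comm]

theorem sum_pow_card (a : ℝ) : ∑ s : Finset (Fin 2), a ^ s.card = (1 + a) ^ 2 := by
  have h := Fintype.sum_pow_mul_eq_add_pow (Fin 2) a 1
  simp only [one_pow, mul_one, Fintype.card_fin] at h
  rw [h, add_comm]

theorem hasSum_geometric_mul_geometric_mul {ι : Type} {x y a : ℝ} {w : ι → ℝ} (hx0 : 0 ≤ x)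
    (hx1 : x < 1) (hy0 : 0 ≤ y) (hy1 : y < 1) (hw : HasSum w a) :
    HasSum (fun p : ℕ × ℕ × ι => x ^ p.1 * (y ^ p.2.1 * w p.2.2))
      ((1 - x)⁻¹ * ((1 - y)⁻¹ * a)) := by
  have hx := hasSum_geometric_of_lt_one hx0 hx1
  have hy := hasSum_geometric_of_lt_one hy0 hy1
  have hys := hy.mul hw (summable_mul_of_summable_norm hy.summable.norm hw.summable.norm)
  exact hx.mul hys (summable_mul_of_summable_norm hx.summable.norm hys.summable.norm)

/-- The bosons contribute two geometric series and each fermion a factor `1 - y`, which cancels one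
of the two series. -/
theorem hasSum_index {x y : ℝ} (hx0 : 0 ≤ x) (hx1 : x < 1) (hy0 : 0 ≤ y) (hy1 : y < 1) :
    HasSum (fun p : ℕ × ℕ × Finset (Fin 2) => x ^ p.1 * (y ^ p.2.1 * (-y) ^ p.2.2.card))
      ((1 - y) / (1 - x)) := by
  have hs : HasSum (fun s : Finset (Fin 2) => (-y) ^ s.card) ((1 - y) ^ 2) := by
    rw [sub_eq_add_neg, ← sum_pow_card]
    exact hasSum_fintype _
  have h := hasSum_geometric_mul_geometric_mul hx0 hx1 hy0 hy1 hs
  have e : (1 - x)⁻¹ * ((1 - y)⁻¹ * (1 - y) ^ 2) = (1 - y) / (1 - x) := by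
    have : 1 - y ≠ 0 := by linarith
    have : 1 - x ≠ 0 := by linarith
    field_simp
  rwa [e] at h

theorem hasWittenIndex_hamiltonian {lam β : ℝ} (h1 : -1 < lam) (h2 : lam < 1) (hβ : 0 < β) :
    HasWittenIndex (hamiltonian lam) β
      (((1 - Real.exp (-β * (1 + lam))) / (1 - Real.exp (-β * (1 - lam))) : ℝ) : ℂ) := by
  have hpos : ∀ p, 0 ≤ energy lam p := fun p =>
    add_nonneg (mul_nonneg (by positivity) (by linarith)) (mul_nonneg (by positivity) (by linarith))
  refine ⟨diagSemigroup stateBasis (energy lam) hpos,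
    isExpSemigroup_diagSemigroup (graph_hamiltonian lam) hpos, ?_⟩
  have hlt : ∀ a : ℝ, 0 < a → Real.exp (-β * a) < 1 := fun a ha => by
    rw [Real.exp_lt_one_iff]
    nlinarith [mul_pos hβ ha]
  have hsum := hasSum_index (Real.exp_pos (-β * (1 - lam))).le (hlt _ (by linarith))
    (Real.exp_pos (-β * (1 + lam))).le (hlt _ (by linarith))
  refine hasTrace_of_basis (b := stateBasis) (fun p => ?_) (Complex.hasSum_ofReal.2 hsum)
  rw [mul_apply_eq_comp, diagSemigroup_basis hpos hβ.le, map_smul, parity_stateBasis, smul_smul]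
  congr 1
  have e : Real.exp (-(β * energy lam p)) = Real.exp (-β * (1 - lam)) ^ p.1
      * (Real.exp (-β * (1 + lam)) ^ p.2.1 * Real.exp (-β * (1 + lam)) ^ p.2.2.card) := by
    rw [← Real.exp_nat_mul, ← Real.exp_nat_mul, ← Real.exp_nat_mul, ← Real.exp_add, ← Real.exp_add,
      energy]
    congr 1
    ring
  rw [e, neg_pow (Real.exp (-β * (1 + lam)))]
  push_cast
  ring

/-- For `lam = 1 - 2 / n` the two Boltzmann factors are `x` and `x ^ (n - 1)`, so the quotient is a
finite geometric sum. -/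
theorem hasWittenIndex_hamiltonian_one_sub_two_div {n : ℕ} {β : ℝ} (hn : 2 ≤ n) (hβ : 0 < β) :
    HasWittenIndex (hamiltonian (1 - 2 / n)) β
      ((∑ m ∈ Finset.range (n - 1), Real.exp (-2 * β * m / n) : ℝ) : ℂ) := by
  have hn' : (2 : ℝ) ≤ n := by exact_mod_cast hn
  have hn0 : (0 : ℝ) < n := by linarith
  have hle : (2 : ℝ) / n ≤ 1 := (div_le_one hn0).2 hn'
  have hpos : (0 : ℝ) < 2 / n := by positivity
  have h := hasWittenIndex_hamiltonian (lam := 1 - 2 / n) (by linarith) (by linarith) hβ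
  have hx : Real.exp (-β * (1 - (1 - 2 / n))) ≠ 1 := by
    rw [Ne, Real.exp_eq_one_iff]
    have := mul_pos hβ hpos
    intro h0
    linarith
  have hy : Real.exp (-β * (1 + (1 - 2 / n))) = Real.exp (-β * (1 - (1 - 2 / n))) ^ (n - 1) := by
    rw [← Real.exp_nat_mul, Nat.cast_sub (by omega)]
    congr 1
    push_cast
    field_simp
    ring
  rw [hy, ← neg_div_neg_eq (1 - _ ^ _), neg_sub, neg_sub, ← geom_sum_eq hx] at h
  convert h using 5 with m
  rw [← Real.exp_nat_mul]
  congr 1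
  field_simp
  ring

/-- The radial quantum number `n` and the angular momentum `l` as a parametrization of the pairs of
numbers of quanta: the number of quanta of angular momentum `-1` is `n + l⁻`, that of quanta of
angular momentum `1` is `n + l⁺`. -/
def quantaEquiv : ℕ × ℤ × Finset (Fin 2) ≃ ℕ × ℕ × Finset (Fin 2) where
  toFun p := (p.1 + (-p.2.1).toNat, p.1 + p.2.1.toNat, p.2.2)
  invFun p := (min p.1 p.2.1, (p.2.1 : ℤ) - p.1, p.2.2)
  left_inv := fun ⟨n, l, s⟩ => by
    ext1
    · dsimp only
      omega
    · ext1
      · dsimp only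
        omega
      · rfl
  right_inv := fun ⟨j, k, s⟩ => by
    ext1
    · dsimp only
      omega
    · ext1
      · dsimp only
        omega
      · rfl

/-- The basis of eigenstates labelled by radial quantum number, angular momentum and fermion
content. -/
def angularBasis : HilbertBasis (ℕ × ℤ × Finset (Fin 2)) ℂ Hilb :=
  HilbertBasis.mkOfOrthogonalEqBot (orthonormal_unitState.comp _ quantaEquiv.injective) (by
    have h : Set.range ((fun p => toHilb (unitState p)) ∘ quantaEquiv)
        = Set.range fun p => toHilb (unitState p) := quantaEquiv.surjective.range_comp _
    rw [h]
    exact orthogonal_span_unitState)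

theorem angularBasis_apply (p : ℕ × ℤ × Finset (Fin 2)) :
    angularBasis p = toHilb (unitState (quantaEquiv p)) := by
  rw [angularBasis, HilbertBasis.coe_mkOfOrthogonalEqBot]
  rfl

theorem energy_quantaEquiv (lam : ℝ) (n : ℕ) (l : ℤ) (s : Finset (Fin 2)) :
    energy lam (quantaEquiv (n, l, s)) = 2 * n + |(l : ℝ)| + s.card + lam * (l + s.card) := by
  have h1 : (((-l).toNat : ℤ) : ℝ) + ((l.toNat : ℤ) : ℝ) = |(l : ℝ)| := by
    rw [← Int.cast_abs, ← Int.cast_add]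
    congr 1
    rcases abs_cases l with h | h <;> omega
  have h2 : ((l.toNat : ℤ) : ℝ) - (((-l).toNat : ℤ) : ℝ) = l := by
    rw [← Int.cast_sub]
    congr 1
    omega
  simp only [energy, quantaEquiv, Equiv.coe_fn_mk]
  push_cast at h1 h2 ⊢
  linear_combination h1 + lam * h2

theorem angMom_unitState_quantaEquiv (n : ℕ) (l : ℤ) (s : Finset (Fin 2)) :
    angMom (unitState (quantaEquiv (n, l, s))) = (l : ℂ) • unitState (quantaEquiv (n, l, s)) := by
  have h : ((l.toNat : ℤ) : ℂ) - (((-l).toNat : ℤ) : ℂ) = l := by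
    rw [← Int.cast_sub]
    congr 1
    omega
  rw [unitState, map_smul, angMom_state, smul_comm, ← h]
  congr 1
  simp only [quantaEquiv, Equiv.coe_fn_mk]
  push_cast
  ring

theorem fermionCharge_unitState (p : ℕ × ℕ × Finset (Fin 2)) :
    fermionCharge (unitState p) = (p.2.2.card : ℂ) • unitState p := by
  rw [unitState, map_smul, fermionCharge_state, smul_comm]

end WeakSusy

end

theorem mainTheorem2 :
    -- the Hamiltonian is a well-defined observable
    (∀ lam : ℝ, IsSelfAdjoint (WeakSusy.hamiltonian lam)) ∧
    -- the explicit spectrum, in a common orthonormal eigenbasis of `L`, `F` and all `H_λ`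
    (∃ (Ψ : ℕ × ℤ × Finset (Fin 2) → WeakSusy.SchwartzState)
        (b : HilbertBasis (ℕ × ℤ × Finset (Fin 2)) ℂ WeakSusy.Hilb),
      ∀ (n : ℕ) (l : ℤ) (s : Finset (Fin 2)),
        b (n, l, s) = WeakSusy.toHilb (Ψ (n, l, s)) ∧
        WeakSusy.angMom (Ψ (n, l, s)) = (l : ℂ) • Ψ (n, l, s) ∧
        WeakSusy.fermionCharge (Ψ (n, l, s)) = (s.card : ℂ) • Ψ (n, l, s) ∧
        ∀ lam : ℝ, WeakSusy.hamLam lam (Ψ (n, l, s)) =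
          ((2 * n + |(l : ℝ)| + s.card + lam * (l + s.card) : ℝ) : ℂ) • Ψ (n, l, s)) ∧
    -- the index for general `λ`, as a geometric series and in closed form
    (∀ lam β : ℝ, -1 < lam → lam < 1 → 0 < β → ∃ I : ℝ,
      WeakSusy.HasWittenIndex (WeakSusy.hamiltonian lam) β (I : ℂ) ∧
      HasSum (fun m : ℕ => (1 - Real.exp (-β * (1 + lam))) * Real.exp (-m * β * (1 - lam))) I ∧
      I = (1 - Real.exp (-β * (1 + lam))) / (1 - Real.exp (-β * (1 - lam)))) ∧
    -- the index for `λ = 1 - 2 / n`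
    (∀ (n : ℕ) (β : ℝ), 2 ≤ n → 0 < β →
      WeakSusy.HasWittenIndex (WeakSusy.hamiltonian (1 - 2 / n)) β
        ((∑ m ∈ Finset.range (n - 1), Real.exp (-2 * β * m / n) : ℝ) : ℂ)) ∧
    -- the case `n = 3`
    (∀ β : ℝ, 0 < β →
      WeakSusy.HasWittenIndex (WeakSusy.hamiltonian (1 / 3)) β
        ((1 + Real.exp (-2 * β / 3) : ℝ) : ℂ)) := by
  refine ⟨WeakSusy.isSelfAdjoint_hamiltonian,
    ⟨fun p => WeakSusy.unitState (WeakSusy.quantaEquiv p), WeakSusy.angularBasis,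
      fun n l s => ⟨WeakSusy.angularBasis_apply _, WeakSusy.angMom_unitState_quantaEquiv n l s,
        WeakSusy.fermionCharge_unitState _, fun lam => ?_⟩⟩,
    fun lam β h1 h2 hβ => ⟨_, WeakSusy.hasWittenIndex_hamiltonian h1 h2 hβ, ?_, rfl⟩,
    fun n β hn hβ => WeakSusy.hasWittenIndex_hamiltonian_one_sub_two_div hn hβ, fun β hβ => ?_⟩
  · rw [WeakSusy.hamLam_unitState, WeakSusy.energy_quantaEquiv]
  · have hlt : Real.exp (-β * (1 - lam)) < 1 := by
      rw [Real.exp_lt_one_iff]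
      nlinarith [mul_pos hβ (sub_pos.2 h2)]
    rw [div_eq_mul_inv]
    refine ((hasSum_geometric_of_lt_one (Real.exp_pos _).le hlt).mul_left _).congr_fun fun m => ?_
    rw [← Real.exp_nat_mul]
    congr 2
    ring
  · have h := WeakSusy.hasWittenIndex_hamiltonian_one_sub_two_div (n := 3) (by norm_num) hβ
    norm_num [Finset.sum_range_succ] at h
    norm_num
    exact h
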